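/- Let $\Sigma_n=\{a_1,\bar a_1,\dots,a_n,\bar a_n\}$. For $w\in\Sigma_n^*$ let $\varphi(w)\in\mathbb{Z}^n$ be the vector of letter balances $\varphi_i(w)=|w|_{a_i}-|w|_{\bar a_i}$, and let $D_n\subseteq\Sigma_n^\omega$ be the set of infinite words all of whose finite prefixes $v$ satisfy $\varphi(v)\ge 0$. A $d$-dimensional Büchi VASS $\mathcal V=(Q,q_0,T,F)$ over $\Sigma_n$ has a finite set $Q$ of states, an initial state $q_0$, final states $F\subseteq Q$, and a finite set $T\subseteq Q\times\Sigma_n^*\times\mathbb{Z}^d\times Q$ of transitions. Its runs start in $(q_0,0)$ and keep the counters in $\mathbb{N}^d$; a run is accepting if it visits $F$ infinitely often; $L(\mathcal V)$ is the set of infinite words that label an accepting run. A language is ($\omega$-)regular if it is the language of a Büchi automaton (the case $d=0$), and $L$ is regularly separable from $D_n$ if there is a regular $R$ with $L\subseteq R$ and $R\cap D_n=\emptyset$. A language $L\subseteq\Sigma_n^\omega$ is pumpable if for all $w\in L$ and $k\in\mathbb{N}$ there are a decomposition $w=w_0w_1$ with $w_0$ finite and a finite prefix $w_0'$ of a word in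 $D_n$ such that $w_0'w_1\in L$, $\varphi(w_0')\ge\varphi(w_0)$, and $\varphi_i(w_0')\ge\max\{\varphi_i(w_0),0\}+k$ for every $i$ such that $\varphi_i(v)<0$ for some finite prefix $v$ of $w$. A Karp–Miller graph of $\mathcal V$ has extended configurations in $Q\times(\mathbb{N}\cup\{\omega\})^d$ as nodes and edges labelled by transitions. It is built from the node $(q_0,0)$ by repeatedly picking a node $(q,m)$ discovered so far and a transition $t=(q,w,\delta,q_2)\in T$ with $m+\delta\ge 0$ (where $\omega+k=\omega$ for $k\in\mathbb{Z}$) that has not yet been taken from $(q,m)$, and adding a $t$-labelled edge to $(q_2,m_2)$, where $m_2$ arises from $m+\delta$ by setting to $\omega$ every counter $i$ for which some path in the current graph from $(q_0,0)$ to $(q,m)$ visits a node $(q_2,m_1)$ with $m_1\le m+\delta$ and $m_1(i)<(m+\delta)(i)$; the construction ends when nothing is left to add. For a path $\sigma$ let $\delta(\sigma)\in\mathbb{Z}^d$ be the sum of the counter effects of its transitions and $\varphi(\sigma)\in\mathbb{Z}^n$ the letter balance of the word it reads. An inseparability flower consists of three non-empty cycles $\alpha,\beta,\gamma$ at a common node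 $(q,m)$ with $q\in F$ such that 1. $\delta(\alpha)+\delta(\beta)+\delta(\gamma)\ge 0$, 2. $\varphi(\alpha)+\varphi(\beta)\ge 0$, 3. $\varphi(\alpha)+\varphi(\beta)+\varphi(\gamma)=r\,\varphi(\alpha)$ for some $r\in\mathbb{Q}$. **Theorem.** Let $\mathcal V$ be a Büchi VASS over $\Sigma_n$ such that every accepting run of $\mathcal V$ is labelled by an infinite word and $L(\mathcal V)$ is pumpable. Then $\mathcal V$ has a Karp–Miller graph, and for every Karp–Miller graph of $\mathcal V$ (that is, for every order of exploration), $L(\mathcal V)$ is not regularly separable from $D_n$ if and only if the graph contains an inseparability flower. Moreover, in that case the graph contains an inseparability flower with $\delta(\alpha)\ge 0$ and, for some integer $N\ge 1$, $\delta(\beta)+\delta(\gamma)=N\,\delta(\alpha)$ and $\varphi(\beta)+\varphi(\gamma)=N\,\varphi(\alpha)$. -/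

import Mathlib

/-! ### The Dyck language of infinite words -/

/-- The alphabet of `n` pairs of matching letters: `(i, true)` is the opening letter of the
`i`-th pair and `(i, false)` is the closing one. -/
abbrev DyckLetter (n : ℕ) : Type := Fin n × Bool

/-- The `i`-th letter balance of a finite word: the number of opening letters minus the number of
closing letters of the `i`-th pair. -/
def letterBalance {n : ℕ} (w : List (DyckLetter n)) (i : Fin n) : ℤ :=
  (w.count (i, true) : ℤ) - (w.count (i, false) : ℤ)

/-- The Dyck language of infinite words: no letter balance of a finite prefix is negative. -/
def dyckLanguage (n : ℕ) : Set (Stream' (DyckLetter n)) :=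
  {w | ∀ (l : ℕ) (i : Fin n), 0 ≤ letterBalance (w.take l) i}

/-- A language `L` is pumpable if for every `w ∈ L` and every `k` some finite prefix `w₀` of `w`
can be replaced, without leaving `L`, by a prefix `v` of a word of the Dyck language, such that
the balance of `v` is at least that of `w₀`, and, in each coordinate where the balance of some
prefix of `w` is negative, it is at least `max (balance of w₀) 0 + k`. -/
def IsPumpable {n : ℕ} (L : Set (Stream' (DyckLetter n))) : Prop :=
  ∀ w ∈ L, ∀ k : ℕ, ∃ (j : ℕ) (v : List (DyckLetter n)),
    v ++ₛ w.drop j ∈ L ∧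
    (∃ z : Stream' (DyckLetter n), v ++ₛ z ∈ dyckLanguage n) ∧
    (∀ i, letterBalance (w.take j) i ≤ letterBalance v i) ∧
    ∀ i, (∃ l, letterBalance (w.take l) i < 0) →
      max (letterBalance (w.take j) i) 0 + (k : ℤ) ≤ letterBalance v i

/-! ### Büchi VASS and their languages -/

/-- A transition of a `d`-dimensional Büchi VASS with state set `Q` over the alphabet `α`. -/
structure VASSTransition (Q : Type*) (d : ℕ) (α : Type*) where
  src : Q
  label : List α
  effect : Fin d → ℤ
  tgt : Q

/-- A `d`-dimensional Büchi VASS with state set `Q` over the alphabet `α`. Finiteness of `Q` is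
required separately. -/
structure BuchiVASS (Q : Type*) (d : ℕ) (α : Type*) where
  init : Q
  trans : Set (VASSTransition Q d α)
  finite_trans : trans.Finite
  final : Set Q

/-- The infinite word `w` is the concatenation of the finite words `u 0, u 1, u 2, …`. -/
def IsConcatenation {α : Type*} (u : ℕ → List α) (w : Stream' α) : Prop :=
  (∀ k, ((List.range k).map u).flatten <+: w.take (((List.range k).map u).flatten.length)) ∧
  ∀ N, ∃ k, N ≤ ((List.range k).map u).flatten.length

namespace BuchiVASS

variable {Q : Type*} {d : ℕ} {α : Type*}

/-- The transitions `t 0, t 1, …` form a run through the configurations `c 0, c 1, …`. -/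
def IsRun (V : BuchiVASS Q d α) (t : ℕ → VASSTransition Q d α)
    (c : ℕ → Q × (Fin d → ℕ)) : Prop :=
  c 0 = (V.init, 0) ∧
  ∀ k, t k ∈ V.trans ∧ (t k).src = (c k).1 ∧ (t k).tgt = (c (k + 1)).1 ∧
    ∀ i, ((c (k + 1)).2 i : ℤ) = ((c k).2 i : ℤ) + (t k).effect i

/-- A run that visits final states infinitely often. -/
def IsAcceptingRun (V : BuchiVASS Q d α) (t : ℕ → VASSTransition Q d α)
    (c : ℕ → Q × (Fin d → ℕ)) : Prop :=
  V.IsRun t c ∧ ∀ N, ∃ k, N ≤ k ∧ (c k).1 ∈ V.final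

/-- The language of a Büchi VASS: all infinite words that label an accepting run. -/
def language (V : BuchiVASS Q d α) : Set (Stream' α) :=
  {w | ∃ t c, V.IsAcceptingRun t c ∧ IsConcatenation (fun k => (t k).label) w}

/-- Every accepting run is labelled by an infinite (rather than a finite) word. -/
def HasInfiniteLabels (V : BuchiVASS Q d α) : Prop :=
  ∀ t c, V.IsAcceptingRun t c → ∃ w, IsConcatenation (fun k => (t k).label) w

end BuchiVASS

/-- An `ω`-regular language: the language of a Büchi automaton, that is, of a Büchi VASS of
dimension zero. -/
def IsOmegaRegular {α : Type*} (R : Set (Stream' α)) : Prop :=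
  ∃ (m : ℕ) (A : BuchiVASS (Fin m) 0 α), A.language = R

/-- Regular separability of two languages of infinite words. -/
def RegularlySeparable {α : Type*} (K L : Set (Stream' α)) : Prop :=
  ∃ R, IsOmegaRegular R ∧ K ⊆ R ∧ Disjoint R L

/-! ### Karp–Miller graphs -/

/-- Extended configurations; the entry `⊤` plays the role of `ω`. -/
abbrev ExtConfig (Q : Type*) (d : ℕ) : Type _ := Q × (Fin d → ℕ∞)

/-- An edge of a Karp–Miller graph: it is labelled by a full transition. -/
structure KMEdge (Q : Type*) (d : ℕ) (α : Type*) where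
  src : ExtConfig Q d
  label : VASSTransition Q d α
  tgt : ExtConfig Q d

/-- `m + δ` is non-negative and equal to `m'`, where `ω + k = ω` for every integer `k`. -/
def IsExtSum {d : ℕ} (m : Fin d → ℕ∞) (δ : Fin d → ℤ) (m' : Fin d → ℕ∞) : Prop :=
  ∀ i, (m i = ⊤ ∧ m' i = ⊤) ∨
    ∃ a b : ℕ, m i = (a : ℕ∞) ∧ m' i = (b : ℕ∞) ∧ (b : ℤ) = (a : ℤ) + δ i

section KarpMiller

variable {Q : Type*} {d : ℕ} {α : Type*}

/-- The edge sequence is a path of the graph `G` from the first to the second configuration. -/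
def IsKMPath (G : Set (KMEdge Q d α)) :
    ExtConfig Q d → List (KMEdge Q d α) → ExtConfig Q d → Prop
  | c, [], c' => c = c'
  | c, e :: p, c' => e ∈ G ∧ e.src = c ∧ IsKMPath G e.tgt p c'

/-- There is a path of `G` from `c` to `c'`. -/
def KMReach (G : Set (KMEdge Q d α)) (c c' : ExtConfig Q d) : Prop :=
  ∃ p, IsKMPath G c p c'

/-- The initial state of a Karp–Miller graph. -/
def BuchiVASS.extInit (V : BuchiVASS Q d α) : ExtConfig Q d := (V.init, 0)

open Classical in
/-- The counter valuation obtained from `m'` by raising to `ω` each counter `i` for which there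
is an extended configuration `(q, m₁)` with `m₁ ≤ m'` and `m₁ i < m' i` on some path of `G` from
the initial configuration to `c`. -/
noncomputable def accelerate (V : BuchiVASS Q d α) (G : Set (KMEdge Q d α)) (c : ExtConfig Q d)
    (q : Q) (m' : Fin d → ℕ∞) : Fin d → ℕ∞ := fun i =>
  if ∃ m₁ : Fin d → ℕ∞, KMReach G V.extInit (q, m₁) ∧ KMReach G (q, m₁) c ∧
    m₁ ≤ m' ∧ m₁ i < m' i then ⊤ else m' i

/-- The graphs (given by their edges) that occur during the Karp–Miller construction: starting
from the initial configuration alone, one repeatedly picks a discovered extended configuration `c`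
and an enabled transition `t` that has not yet been taken from `c`, and adds the edge for taking
it. -/
inductive KMConstruction (V : BuchiVASS Q d α) : Set (KMEdge Q d α) → Prop
  | start : KMConstruction V ∅
  | extend (G : Set (KMEdge Q d α)) (c : ExtConfig Q d) (t : VASSTransition Q d α)
      (m' : Fin d → ℕ∞) (hG : KMConstruction V G) (hc : KMReach G V.extInit c)
      (ht : t ∈ V.trans) (hsrc : t.src = c.1) (hm : IsExtSum c.2 t.effect m')
      (hnew : ∀ e ∈ G, ¬ (e.src = c ∧ e.label = t)) :
      KMConstruction V (insert ⟨c, t, (t.tgt, accelerate V G c t.tgt m')⟩ G)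

/-- `G` is a Karp–Miller graph of `V`: it results from the construction, and every transition that
is enabled in an extended configuration of `G` has been taken. (Different orders of exploration
may give different graphs.) -/
def IsKarpMillerGraph (V : BuchiVASS Q d α) (G : Set (KMEdge Q d α)) : Prop :=
  KMConstruction V G ∧
  ∀ (c : ExtConfig Q d) (t : VASSTransition Q d α) (m' : Fin d → ℕ∞),
    KMReach G V.extInit c → t ∈ V.trans → t.src = c.1 → IsExtSum c.2 t.effect m' →
    ∃ e ∈ G, e.src = c ∧ e.label = t

/-- A (non-empty) cycle of `G` at `c`. -/
def IsKMCycle (G : Set (KMEdge Q d α)) (c : ExtConfig Q d) (p : List (KMEdge Q d α)) : Prop :=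
  p ≠ [] ∧ IsKMPath G c p c

/-- The counter effect of an edge sequence. -/
def counterEffect (p : List (KMEdge Q d α)) : Fin d → ℤ :=
  (p.map fun e => e.label.effect).sum

/-- The letter balance of the word read along an edge sequence. -/
def pathBalance {n : ℕ} (p : List (KMEdge Q d (DyckLetter n))) : Fin n → ℤ :=
  letterBalance (p.flatMap fun e => e.label.label)

/-- An inseparability flower of `G`: three cycles at a common final extended configuration such
that the total counter effect is non-negative, the balance of the first two cycles together is
non-negative, and the total balance is a scalar multiple of the balance of the first cycle. -/
structure IsInseparabilityFlower {n : ℕ} (V : BuchiVASS Q d (DyckLetter n))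
    (G : Set (KMEdge Q d (DyckLetter n))) (c : ExtConfig Q d)
    (a b g : List (KMEdge Q d (DyckLetter n))) : Prop where
  final : c.1 ∈ V.final
  cycle_a : IsKMCycle G c a
  cycle_b : IsKMCycle G c b
  cycle_g : IsKMCycle G c g
  effect_nonneg : 0 ≤ counterEffect a + counterEffect b + counterEffect g
  balance_nonneg : 0 ≤ pathBalance a + pathBalance b
  balance_multiple : ∃ r : ℚ, ∀ i,
    ((pathBalance a i + pathBalance b i + pathBalance g i : ℤ) : ℚ) = r * (pathBalance a i : ℚ)

end KarpMiller

/-! A flower prevents separation by a pumping argument. Let `R` be regular with `L(V) ⊆ R`. Finite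
words have a congruence of finite index under which factors may be exchanged inside members of `R`
(`IsOmegaRegular.exists_congruence`), and some `K > 0` makes `u ^ (xK)` congruent to `u ^ K` for all
`x > 0`, where `u` is the word of any of the three cycles. Since the total effect of the flower is
non-negative and its node can be covered with arbitrarily large `ω`-counters
(`KMConstruction.coverable`), `L(V)` contains a word `W B₀ B₀ …` with `B₀ = α^K β^K γ^K`.
Pumpability improves a finite prefix of it. Then every later `B₀` is exchanged for `B₁ = α^(xK)
β^(yK) γ^(zK)`, which stays in `R`. By condition 3 the numbers `x, y, z` can be chosen so that the
balance of `B₁` is a non-negative multiple of `φ(α) + φ(β)`, hence non-negative. The coordinates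
that were ever negative are protected by the pumped reserve; the others by their non-negativity in
the original word. So the new word lies in `R ∩ D_n`.

Conversely, every accepting run follows a path of the graph, and the edges it uses infinitely often
form a closed walk `a` at a final node; by Dickson's lemma `a` can be taken with non-negative
counter effect (`exists_cycle_of_path`). Farkas' lemma leaves two cases
(`exists_circulation_or_potential`). If a circulation uses exactly the edges of `a`, each at least
once, and has non-negative balance, then multiples of it and of `a` are split into Eulerian cycles,
giving a flower of the special form in the last claim (`exists_flower_of_circulation`). Otherwise
there are weights `y ≥ 0` and a potential `π` on nodes such that the `y`-weighted balance plus `π`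
increases along no edge of `a` and strictly decreases along one. A finite automaton can guess such a
certificate and check that the path eventually respects it (`separator`). On an accepted word the
weighted balance tends to `-∞`, so no accepted word is in `D_n`; if there is no special flower, all
of `L(V)` is accepted. This proves both the equivalence and the special form, for every exploration
order.

That some graph exists is the termination of the Karp–Miller construction: König's lemma together
with the well-quasi-order on extended configurations. -/

/-! ### Concatenations of finite words -/

section Concatenation

variable {α β : Type*}

/-- The concatenation of the first `k` words of a sequence. -/
def concatPrefix (u : ℕ → List α) (k : ℕ) : List α := ((List.range k).map u).flatten

@[simp] theorem concatPrefix_zero (u : ℕ → List α) : concatPrefix u 0 = [] := rfl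

theorem concatPrefix_succ (u : ℕ → List α) (k : ℕ) :
    concatPrefix u (k + 1) = concatPrefix u k ++ u k := by
  simp [concatPrefix, List.range_succ]

theorem concatPrefix_add (u : ℕ → List α) (a b : ℕ) :
    concatPrefix u (a + b) = concatPrefix u a ++ concatPrefix (fun i => u (a + i)) b := by
  induction b with
  | zero => simp
  | succ b ih => rw [← Nat.add_assoc, concatPrefix_succ, ih, concatPrefix_succ, List.append_assoc]

theorem concatPrefix_succ' (u : ℕ → List α) (k : ℕ) :
    concatPrefix u (k + 1) = u 0 ++ concatPrefix (fun i => u (i + 1)) k := by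
  rw [Nat.add_comm, concatPrefix_add, concatPrefix_succ]
  simp [Nat.add_comm]

theorem concatPrefix_isPrefix (u : ℕ → List α) {a b : ℕ} (h : a ≤ b) :
    concatPrefix u a <+: concatPrefix u b := by
  obtain ⟨c, rfl⟩ := Nat.exists_eq_add_of_le h
  exact ⟨_, (concatPrefix_add u a c).symm⟩

theorem concatPrefix_length_mono (u : ℕ → List α) {a b : ℕ} (h : a ≤ b) :
    (concatPrefix u a).length ≤ (concatPrefix u b).length :=
  (concatPrefix_isPrefix u h).length_le

theorem concatPrefix_flatMap (u : ℕ → List α) (f : α → List β) (k : ℕ) :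
    concatPrefix (fun j => (u j).flatMap f) k = (concatPrefix u k).flatMap f := by
  induction k with
  | zero => simp
  | succ k ih => rw [concatPrefix_succ, concatPrefix_succ, ih, List.flatMap_append]

theorem concatPrefix_take_flatMap (t : Stream' α) (f : α → List β) (k : ℕ) :
    concatPrefix (fun j => f (t j)) k = (t.take k).flatMap f := by
  induction k with
  | zero => simp
  | succ k ih =>
    rw [concatPrefix_succ, Stream'.take_succ', ih, List.flatMap_append]
    simp [Stream'.get]

theorem Stream'.take_isPrefix (w : Stream' α) {a b : ℕ} (h : a ≤ b) : w.take a <+: w.take b := by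
  have := Stream'.take_take (s := w) (m := a) (n := b)
  rw [min_eq_right h] at this
  exact this ▸ List.take_prefix _ _

theorem isConcatenation_iff {u : ℕ → List α} {w : Stream' α} :
    IsConcatenation u w ↔
      (∀ k, concatPrefix u k = w.take (concatPrefix u k).length) ∧
      ∀ N, ∃ k, N ≤ (concatPrefix u k).length := by
  refine and_congr (forall_congr' fun k => ?_) Iff.rfl
  constructor
  · intro h
    exact h.eq_of_length (by rw [Stream'.length_take])
  · intro h
    change concatPrefix u k <+: w.take (concatPrefix u k).length
    rw [← h]

theorem IsConcatenation.prefix_eq {u : ℕ → List α} {w : Stream' α} (h : IsConcatenation u w)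
    (k : ℕ) : concatPrefix u k = w.take (concatPrefix u k).length :=
  (isConcatenation_iff.1 h).1 k

theorem IsConcatenation.unbounded {u : ℕ → List α} {w : Stream' α} (h : IsConcatenation u w)
    (N : ℕ) : ∃ k, N ≤ (concatPrefix u k).length := h.2 N

/-- The prefixes are nested, so agreement with `w` at arbitrarily late ones forces agreement at all.
-/
theorem isConcatenation_of_frequently {u : ℕ → List α} {w : Stream' α}
    (h : ∀ N, ∃ k, N ≤ k ∧ concatPrefix u k = w.take (concatPrefix u k).length)
    (hu : ∀ N, ∃ k, N ≤ (concatPrefix u k).length) : IsConcatenation u w := by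
  refine isConcatenation_iff.2 ⟨fun k => ?_, hu⟩
  obtain ⟨m, hkm, hm⟩ := h k
  have h1 := concatPrefix_isPrefix u hkm
  have h2 := w.take_isPrefix h1.length_le
  rw [← hm] at h2
  exact (List.prefix_of_prefix_length_le h1 h2 (by simp)).eq_of_length (by simp)

theorem exists_isConcatenation {u : ℕ → List α} (hu : ∀ N, ∃ k, N ≤ (concatPrefix u k).length) :
    ∃ w, IsConcatenation u w := by
  choose K hK using fun i => hu (i + 1)
  obtain ⟨w, hw⟩ : ∃ w : Stream' α, ∀ i, w.get i = (concatPrefix u (K i))[i]'(hK i) :=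
    ⟨fun i => (concatPrefix u (K i))[i]'(hK i), fun i => rfl⟩
  refine ⟨w, isConcatenation_iff.2 ⟨fun k => ?_, hu⟩⟩
  apply List.ext_getElem (by rw [Stream'.length_take])
  intro i h1 h2
  rw [Stream'.take_get, hw]
  rcases le_total k (K i) with h | h
  · exact (concatPrefix_isPrefix u h).getElem h1
  · exact ((concatPrefix_isPrefix u h).getElem (hK i)).symm

/-- Passing from the labels of single transitions to the labels of finite blocks of them. -/
theorem isConcatenation_coarsen {σ : ℕ → List α} {t : Stream' α} (h : IsConcatenation σ t)
    (f : α → List β) (w : Stream' β) :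
    IsConcatenation (fun k => f (t k)) w ↔ IsConcatenation (fun j => (σ j).flatMap f) w := by
  have key : ∀ j, concatPrefix (fun j => (σ j).flatMap f) j =
      concatPrefix (fun k => f (t k)) (concatPrefix σ j).length := by
    intro j
    rw [concatPrefix_flatMap, concatPrefix_take_flatMap, ← h.prefix_eq j]
  constructor
  · intro hw
    refine isConcatenation_iff.2 ⟨fun k => ?_, fun N => ?_⟩
    · rw [key]; exact hw.prefix_eq _
    · obtain ⟨k, hk⟩ := hw.unbounded N
      obtain ⟨j, hj⟩ := h.unbounded k
      refine ⟨j, ?_⟩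
      rw [key]
      exact hk.trans (concatPrefix_length_mono _ hj)
  · intro hw
    refine isConcatenation_of_frequently (fun N => ?_) (fun N => ?_)
    · obtain ⟨j, hj⟩ := h.unbounded N
      refine ⟨_, hj, ?_⟩
      rw [← key]; exact hw.prefix_eq _
    · obtain ⟨j, hj⟩ := hw.unbounded N
      rw [key] at hj
      exact ⟨_, hj⟩

theorem Stream'.drop_take (w : Stream' α) (a b : ℕ) :
    (w.take b).drop a = (w.drop a).take (b - a) := by
  rcases le_total a b with h | h
  · obtain ⟨c, rfl⟩ := Nat.exists_eq_add_of_le h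
    rw [Stream'.take_add, List.drop_append_of_le_length (by simp)]
    simp
  · rw [Nat.sub_eq_zero_of_le h, List.drop_of_length_le (by simpa using h)]
    simp

theorem Stream'.take_append_length_add (x : List α) (w : Stream' α) (k : ℕ) :
    (x ++ₛ w).take (x.length + k) = x ++ w.take k := by
  rw [Stream'.take_add, Stream'.drop_append_stream]
  congr 1
  exact (Stream'.take_append_of_le_length _ x w le_rfl).trans List.take_length

theorem IsConcatenation.cons {u : ℕ → List α} {w : Stream' α} (h : IsConcatenation u w)
    (x : List α) : IsConcatenation (fun i => Nat.casesOn i x u) (x ++ₛ w) := by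
  have key : ∀ k, concatPrefix (fun i => Nat.casesOn i x u) (k + 1) = x ++ concatPrefix u k :=
    fun k => concatPrefix_succ' _ k
  refine isConcatenation_of_frequently (fun N => ⟨N + 1, by omega, ?_⟩) (fun N => ?_)
  · rw [key, List.length_append, Stream'.take_append_length_add, ← h.prefix_eq]
  · obtain ⟨k, hk⟩ := h.unbounded N
    exact ⟨k + 1, by rw [key, List.length_append]; omega⟩

theorem IsConcatenation.drop {u : ℕ → List α} {w : Stream' α} (h : IsConcatenation u w) (j : ℕ) :
    IsConcatenation (fun i => u (j + i)) (w.drop (concatPrefix u j).length) := by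
  refine isConcatenation_iff.2 ⟨fun k => ?_, fun N => ?_⟩
  · have h1 := h.prefix_eq (j + k)
    rw [concatPrefix_add, List.length_append, Stream'.take_add, ← h.prefix_eq j] at h1
    exact List.append_cancel_left h1
  · obtain ⟨k, hk⟩ := h.unbounded (N + (concatPrefix u j).length)
    refine ⟨k, ?_⟩
    have h1 := concatPrefix_length_mono u (show k ≤ j + k by omega)
    rw [concatPrefix_add, List.length_append] at h1
    omega

theorem Stream'.append_drop_eq (v : List α) (w : Stream' α) {j l : ℕ} (h : j ≤ l) :
    v ++ₛ w.drop j = (v ++ (w.take l).drop j) ++ₛ w.drop l := by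
  have h2 : w.drop l = (w.drop j).drop (l - j) := by
    rw [Stream'.drop_drop]; congr 1; omega
  rw [Stream'.append_append_stream, Stream'.drop_take, h2, Stream'.append_take_drop]

end Concatenation

/-! ### Runs as sequences of finite firing sequences -/

section Runs

variable {Q : Type*} {d : ℕ} {α : Type*}

/-- The transitions `σ` can be fired one after the other from `c`, leading to `c'`. -/
def BuchiVASS.Steps (V : BuchiVASS Q d α) :
    Q × (Fin d → ℕ) → List (VASSTransition Q d α) → Q × (Fin d → ℕ) → Prop
  | c, [], c' => c = c'
  | c, t :: σ, c' => t ∈ V.trans ∧ t.src = c.1 ∧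
      ∃ x : Fin d → ℕ, (∀ i, (x i : ℤ) = (c.2 i : ℤ) + t.effect i) ∧ V.Steps (t.tgt, x) σ c'

theorem BuchiVASS.steps_append {V : BuchiVASS Q d α} {σ τ : List (VASSTransition Q d α)}
    {c c' : Q × (Fin d → ℕ)} :
    V.Steps c (σ ++ τ) c' ↔ ∃ b, V.Steps c σ b ∧ V.Steps b τ c' := by
  induction σ generalizing c with
  | nil => simp [BuchiVASS.Steps]
  | cons t σ ih =>
    simp only [List.cons_append, BuchiVASS.Steps, ih]
    constructor
    · rintro ⟨h1, h2, x, h3, b, h4, h5⟩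
      exact ⟨b, ⟨h1, h2, x, h3, h4⟩, h5⟩
    · rintro ⟨b, ⟨h1, h2, x, h3, h4⟩, h5⟩
      exact ⟨h1, h2, x, h3, b, h4, h5⟩

theorem BuchiVASS.Steps.unique {V : BuchiVASS Q d α} {σ : List (VASSTransition Q d α)}
    {c a b : Q × (Fin d → ℕ)} (ha : V.Steps c σ a) (hb : V.Steps c σ b) : a = b := by
  induction σ generalizing c with
  | nil => exact ha.symm.trans hb
  | cons t σ ih =>
    obtain ⟨-, -, x, hx, hxa⟩ := ha
    obtain ⟨-, -, y, hy, hyb⟩ := hb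
    have : x = y := funext fun i => by have := hx i; have := hy i; omega
    subst this
    exact ih hxa hyb

theorem BuchiVASS.steps_take {V : BuchiVASS Q d α} {t : Stream' (VASSTransition Q d α)}
    {c : ℕ → Q × (Fin d → ℕ)} (h : V.IsRun t c) (k : ℕ) :
    V.Steps (V.init, 0) (Stream'.take k t) (c k) := by
  induction k with
  | zero => exact h.1.symm
  | succ k ih =>
    rw [Stream'.take_succ']
    refine steps_append.2 ⟨_, ih, (h.2 k).1, (h.2 k).2.1, (c (k + 1)).2, (h.2 k).2.2.2, ?_⟩
    exact Prod.ext (h.2 k).2.2.1 rfl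

theorem BuchiVASS.steps_drop_take {V : BuchiVASS Q d α} {t : Stream' (VASSTransition Q d α)}
    {c : ℕ → Q × (Fin d → ℕ)} (h : V.IsRun t c) (j k : ℕ) :
    V.Steps (c j) (Stream'.take k (Stream'.drop j t)) (c (j + k)) := by
  have h1 := steps_take h (j + k)
  rw [Stream'.take_add] at h1
  obtain ⟨b, h2, h3⟩ := steps_append.1 h1
  rwa [h2.unique (steps_take h j)] at h3

theorem BuchiVASS.steps_concatPrefix {V : BuchiVASS Q d α}
    {σ : ℕ → List (VASSTransition Q d α)} {C : ℕ → Q × (Fin d → ℕ)}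
    (hσ : ∀ j, V.Steps (C j) (σ j) (C (j + 1))) (j : ℕ) :
    V.Steps (C 0) (concatPrefix σ j) (C j) := by
  induction j with
  | zero => rfl
  | succ j ih => rw [concatPrefix_succ]; exact steps_append.2 ⟨_, ih, hσ j⟩

/-- Bridges block-wise and step-wise views: firing is deterministic once the transitions are fixed,
so the configurations between block boundaries are recovered from the prefixes of the glued
sequence. -/
theorem BuchiVASS.exists_run_of_steps {V : BuchiVASS Q d α}
    {σ : ℕ → List (VASSTransition Q d α)} {C : ℕ → Q × (Fin d → ℕ)}
    (h0 : C 0 = (V.init, 0)) (hσ : ∀ j, V.Steps (C j) (σ j) (C (j + 1)))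
    (hu : ∀ N, ∃ k, N ≤ (concatPrefix σ k).length) :
    ∃ (t : Stream' (VASSTransition Q d α)) (c : ℕ → Q × (Fin d → ℕ)), V.IsRun t c ∧ IsConcatenation σ t ∧ ∀ j, c (concatPrefix σ j).length = C j := by
  obtain ⟨t, ht⟩ := exists_isConcatenation hu
  have hpre : ∀ j, V.Steps (V.init, 0) (concatPrefix σ j) (C j) := fun j =>
    h0 ▸ steps_concatPrefix hσ j
  have hex : ∀ k, ∃ b, V.Steps (V.init, 0) (t.take k) b := by
    intro k
    obtain ⟨j, hj⟩ := hu k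
    have h1 := hpre j
    rw [ht.prefix_eq j] at h1
    obtain ⟨r, hr⟩ := t.take_isPrefix hj
    rw [← hr] at h1
    obtain ⟨b, hb, -⟩ := steps_append.1 h1
    exact ⟨b, hb⟩
  choose c hc using hex
  refine ⟨t, c, ⟨(hc 0).symm, fun k => ?_⟩, ht, fun j => ?_⟩
  · have h1 := hc (k + 1)
    rw [Stream'.take_succ'] at h1
    obtain ⟨b, hb, h2, h3, x, hx, h4⟩ := steps_append.1 h1
    rw [hb.unique (hc k)] at h3 hx
    rw [← show (t.get k).tgt = (c (k + 1)).1 from congrArg Prod.fst h4]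
    have h5 : x = (c (k + 1)).2 := congrArg Prod.snd h4
    exact ⟨h2, h3, rfl, h5 ▸ hx⟩
  · have h1 := hpre j
    rw [ht.prefix_eq j] at h1
    exact (hc _).unique h1

theorem BuchiVASS.mem_language_of_steps {V : BuchiVASS Q d α}
    {σ : ℕ → List (VASSTransition Q d α)} {C : ℕ → Q × (Fin d → ℕ)} {w : Stream' α}
    (h0 : C 0 = (V.init, 0)) (hσ : ∀ j, V.Steps (C j) (σ j) (C (j + 1)))
    (hu : ∀ N, ∃ k, N ≤ (concatPrefix σ k).length)
    (hF : ∀ N, ∃ j τ ρ b, N ≤ j ∧ σ j = τ ++ ρ ∧ V.Steps (C j) τ b ∧ b.1 ∈ V.final)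
    (hw : IsConcatenation (fun j => (σ j).flatMap VASSTransition.label) w) :
    w ∈ V.language := by
  obtain ⟨t, c, hrun, ht, hc⟩ := exists_run_of_steps h0 hσ hu
  refine ⟨t, c, ⟨hrun, fun N => ?_⟩, (isConcatenation_coarsen ht _ w).2 hw⟩
  obtain ⟨k, hk⟩ := hu N
  obtain ⟨j, τ, ρ, b, hj, hτ, hb, hbF⟩ := hF k
  refine ⟨(concatPrefix σ j).length + τ.length,
    (hk.trans (concatPrefix_length_mono σ hj)).trans (Nat.le_add_right _ _), ?_⟩
  have h1 : V.Steps (V.init, 0) (concatPrefix σ j ++ τ) b :=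
    steps_append.2 ⟨C j, h0 ▸ steps_concatPrefix hσ j, hb⟩
  have h2 : concatPrefix σ j ++ τ = Stream'.take ((concatPrefix σ j).length + τ.length) t := by
    have h3 := ht.prefix_eq (j + 1)
    rw [concatPrefix_succ, hτ, ← List.append_assoc] at h3
    have h4 : concatPrefix σ j ++ τ <+: t.take (concatPrefix σ j ++ τ ++ ρ).length :=
      h3 ▸ List.prefix_append _ _
    have h5 := t.take_isPrefix (show (concatPrefix σ j).length + τ.length ≤
      (concatPrefix σ j ++ τ ++ ρ).length by simp)
    exact (List.prefix_of_prefix_length_le h4 h5 (by simp)).eq_of_length (by simp)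
  rw [h2] at h1
  rwa [(steps_take hrun _).unique h1]

end Runs

/-! ### Büchi automata recognize with finitely many profiles of finite words -/

section Profiles

universe u

variable {S : Type*} {α : Type*}

/-- The word read along a firing sequence. -/
abbrev labelWord {Q : Type*} {d : ℕ} (σ : List (VASSTransition Q d α)) : List α :=
  σ.flatMap VASSTransition.label

theorem BuchiVASS.Steps.mem_trans {Q : Type*} {d : ℕ} {V : BuchiVASS Q d α}
    {σ : List (VASSTransition Q d α)} {c c' : Q × (Fin d → ℕ)} (h : V.Steps c σ c') :
    ∀ t ∈ σ, t ∈ V.trans := by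
  induction σ generalizing c with
  | nil => simp
  | cons t σ ih =>
    obtain ⟨h1, -, x, -, h2⟩ := h
    simpa [h1] using ih h2

theorem BuchiVASS.exists_label_length_le {Q : Type*} {d : ℕ} (V : BuchiVASS Q d α) :
    ∃ L, ∀ t ∈ V.trans, t.label.length ≤ L := by
  obtain ⟨L, hL⟩ := (V.finite_trans.image fun t => t.label.length).bddAbove
  exact ⟨L, fun t ht => hL ⟨t, ht, rfl⟩⟩

theorem length_labelWord_le {Q : Type*} {d : ℕ} {σ : List (VASSTransition Q d α)} {L : ℕ}
    (h : ∀ t ∈ σ, t.label.length ≤ L) : (labelWord σ).length ≤ σ.length * L := by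
  induction σ with
  | nil => simp
  | cons t σ ih =>
    have h1 := ih fun t ht => h t (List.mem_cons_of_mem _ ht)
    have h2 := h t List.mem_cons_self
    rw [labelWord, List.flatMap_cons, List.length_append, List.length_cons, Nat.succ_mul]
    simp only [labelWord] at h1
    omega

/-- A state of an automaton together with a bounded word that the automaton has read ahead. -/
abbrev ReadAheadState (S α : Type*) (L : ℕ) : Type _ :=
  (S × (Fin 0 → ℕ)) × {r : List α // r.length ≤ L}

/-- The state changes that are possible while reading a word. -/
def BuchiVASS.profile (V : BuchiVASS S 0 α) (L : ℕ) (u : List α) :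
    Set (ReadAheadState S α L × ReadAheadState S α L) :=
  {x | ∃ σ, V.Steps x.1.1 σ x.2.1 ∧ x.1.2 ++ labelWord σ = u ++ x.2.2}

/-- The state changes that are possible while reading a word and visiting a final state. -/
def BuchiVASS.finalProfile (V : BuchiVASS S 0 α) (L : ℕ) (u : List α) :
    Set (ReadAheadState S α L × ReadAheadState S α L) :=
  {x | ∃ σ τ b, V.Steps x.1.1 σ b ∧ b.1 ∈ V.final ∧ V.Steps b τ x.2.1 ∧
    x.1.2 ++ labelWord (σ ++ τ) = u ++ x.2.2}

/-- A boundary between two factors may fall inside the label of a transition. Cutting after that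
transition leaves an overhang `s` which is a suffix of one label or of the initial overhang `r`,
hence of length at most `L`. -/
theorem exists_split_labelWord {L : ℕ} (σ : List (VASSTransition S 0 α))
    (hσ : ∀ t ∈ σ, t.label.length ≤ L) (r u v : List α) (hr : r.length ≤ L)
    (h : r ++ labelWord σ = u ++ v) :
    ∃ σ₁ σ₂ s, σ = σ₁ ++ σ₂ ∧ s.length ≤ L ∧ r ++ labelWord σ₁ = u ++ s ∧
      s ++ labelWord σ₂ = v := by
  induction σ generalizing r u with
  | nil =>
    simp only [List.flatMap_nil, List.append_nil] at h
    exact ⟨[], [], v, rfl, by rw [h] at hr; simp at hr; omega, by simpa using h, by simp⟩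
  | cons t σ ih =>
    rcases List.append_eq_append_iff.1 h with ⟨a, rfl, ha⟩ | ⟨a, rfl, ha⟩
    · obtain ⟨σ₁, σ₂, s, rfl, h1, h2, h3⟩ :=
        ih (fun t ht => hσ t (List.mem_cons_of_mem _ ht)) t.label a (hσ t List.mem_cons_self)
          (by simpa using ha)
      exact ⟨t :: σ₁, σ₂, s, rfl, h1, by simpa using h2, h3⟩
    · exact ⟨[], t :: σ, a, rfl, by simp at hr; omega, by simp, ha.symm⟩

theorem BuchiVASS.profile_append (V : BuchiVASS S 0 α) {L : ℕ}
    (hL : ∀ t ∈ V.trans, t.label.length ≤ L) (u v : List α) :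
    V.profile L (u ++ v) =
      {x | ∃ p, (x.1, p) ∈ V.profile L u ∧ (p, x.2) ∈ V.profile L v} := by
  ext ⟨p, q⟩
  constructor
  · rintro ⟨σ, hσ, h⟩
    rw [List.append_assoc] at h
    obtain ⟨σ₁, σ₂, s, rfl, h1, h2, h3⟩ := exists_split_labelWord σ
      (fun t ht => hL t (hσ.mem_trans t ht)) _ _ _ p.2.2 h
    obtain ⟨b, hb1, hb2⟩ := steps_append.1 hσ
    exact ⟨(b, ⟨s, h1⟩), ⟨σ₁, hb1, h2⟩, ⟨σ₂, hb2, h3⟩⟩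
  · rintro ⟨m, ⟨σ₁, h1, h2⟩, ⟨σ₂, h3, h4⟩⟩
    refine ⟨σ₁ ++ σ₂, steps_append.2 ⟨_, h1, h3⟩, ?_⟩
    dsimp only at h2 h4 ⊢
    rw [labelWord, List.flatMap_append, ← List.append_assoc, h2, List.append_assoc, h4,
      List.append_assoc]

theorem BuchiVASS.finalProfile_append (V : BuchiVASS S 0 α) {L : ℕ}
    (hL : ∀ t ∈ V.trans, t.label.length ≤ L) (u v : List α) :
    V.finalProfile L (u ++ v) =
      {x | ∃ p, ((x.1, p) ∈ V.finalProfile L u ∧ (p, x.2) ∈ V.profile L v) ∨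
        ((x.1, p) ∈ V.profile L u ∧ (p, x.2) ∈ V.finalProfile L v)} := by
  ext ⟨p, q⟩
  constructor
  · rintro ⟨σ, τ, b, hσ, hb, hτ, h⟩
    rw [List.append_assoc] at h
    obtain ⟨σ₁, σ₂, s, h0, h1, h2, h3⟩ := exists_split_labelWord (σ ++ τ)
      (fun t ht => (List.mem_append.1 ht).elim (fun h => hL t (hσ.mem_trans t h))
        fun h => hL t (hτ.mem_trans t h)) _ _ _ p.2.2 h
    rcases List.append_eq_append_iff.1 h0 with ⟨a, rfl, rfl⟩ | ⟨a, rfl, rfl⟩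
    · obtain ⟨m, hm1, hm2⟩ := steps_append.1 hτ
      exact ⟨(m, ⟨s, h1⟩), Or.inl ⟨⟨σ, a, b, hσ, hb, hm1, h2⟩, ⟨σ₂, hm2, h3⟩⟩⟩
    · obtain ⟨m, hm1, hm2⟩ := steps_append.1 hσ
      exact ⟨(m, ⟨s, h1⟩), Or.inr ⟨⟨σ₁, hm1, h2⟩, ⟨a, τ, b, hm2, hb, hτ, h3⟩⟩⟩
  · rintro ⟨m, ⟨⟨σ, τ, b, hσ, hb, hτ, h2⟩, ⟨σ₂, h3, h4⟩⟩ |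
      ⟨⟨σ₁, h1, h2⟩, ⟨σ, τ, b, hσ, hb, hτ, h4⟩⟩⟩
    · refine ⟨σ, τ ++ σ₂, b, hσ, hb, steps_append.2 ⟨_, hτ, h3⟩, ?_⟩
      dsimp only at h2 h4 ⊢
      rw [← List.append_assoc σ, labelWord, List.flatMap_append, ← List.append_assoc, h2,
        List.append_assoc, h4, List.append_assoc]
    · refine ⟨σ₁ ++ σ, τ, b, steps_append.2 ⟨_, h1, hσ⟩, hb, hτ, ?_⟩
      dsimp only at h2 h4 ⊢
      rw [List.append_assoc σ₁, labelWord, List.flatMap_append, ← List.append_assoc, h2,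
        List.append_assoc, h4, List.append_assoc]

/-- Cut an accepting run for `w` at the boundaries of the factors `U j`, keeping the overhangs.
Equal profiles let each piece be replaced by one reading `U' j` between the same endpoints, and
equal final profiles preserve the visits to final states. -/
theorem BuchiVASS.mem_language_of_profiles (V : BuchiVASS S 0 α) {L : ℕ}
    (hL : ∀ t ∈ V.trans, t.label.length ≤ L) {U U' : ℕ → List α} {w w' : Stream' α}
    (h0 : ∀ j, V.profile L (U j) = V.profile L (U' j))
    (hF : ∀ j, V.finalProfile L (U j) = V.finalProfile L (U' j))
    (hU : IsConcatenation U w) (hU' : IsConcatenation U' w') (hw : w ∈ V.language) :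
    w' ∈ V.language := by
  classical
  obtain ⟨t', c, ⟨hrun, hfin⟩, hlab'⟩ := hw
  obtain ⟨t, ht⟩ : ∃ t : Stream' (VASSTransition S 0 α), t = t' := ⟨t', rfl⟩
  subst ht
  obtain ⟨u, hu⟩ : ∃ u : ℕ → List α, u = fun k => (t.get k).label := ⟨_, rfl⟩
  have hlab : IsConcatenation u w := hu ▸ hlab'
  set l : ℕ → ℕ := fun j => (concatPrefix U j).length with hl
  have hex : ∀ j, ∃ k, l j ≤ (concatPrefix u k).length := fun j => hlab.unbounded _
  -- `K j` is the first time at which the run has read the first `j` factors; by minimality the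
  -- overhang lies inside the last label and is bounded by `L`.
  set K : ℕ → ℕ := fun j => Nat.find (hex j) with hK
  have hK1 : ∀ j, l j ≤ (concatPrefix u (K j)).length := fun j => Nat.find_spec (hex j)
  have hK0 : K 0 = 0 := (Nat.find_eq_zero _).2 (by simp [hl])
  have hKmono : ∀ j, K j ≤ K (j + 1) := fun j =>
    Nat.find_min' _ ((concatPrefix_length_mono U (Nat.le_succ j)).trans (hK1 (j + 1)))
  have hKm : Monotone K := monotone_nat_of_le_succ hKmono
  have hulen : ∀ k, (u k).length ≤ L := fun k => by
    rw [hu]; exact hL _ (hrun.2 k).1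
  have hr : ∀ j, ((concatPrefix u (K j)).drop (l j)).length ≤ L := by
    intro j
    rcases Nat.eq_zero_or_eq_succ_pred (K j) with h | h
    · rw [h]; simp
    · have h1 : ¬ l j ≤ (concatPrefix u (K j).pred).length :=
        Nat.find_min (hex j) (by change _ < K j; omega)
      have h2 := hulen (K j).pred
      rw [h, Nat.succ_eq_add_one, concatPrefix_succ, List.length_drop, List.length_append]
      omega
  set p : ℕ → ReadAheadState S α L := fun j => (c (K j), ⟨_, hr j⟩) with hp
  have hlabw : ∀ a b, labelWord ((t.drop a).take b) = concatPrefix (fun i => u (a + i)) b := by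
    intro a b
    rw [labelWord, ← concatPrefix_take_flatMap]
    change concatPrefix (fun j => ((t.drop a).get j).label) b = _
    simp only [Stream'.get_drop, hu]
  have hword : ∀ j, (concatPrefix u (K j)).drop (l j) ++
      labelWord ((t.drop (K j)).take (K (j + 1) - K j)) =
      U j ++ (concatPrefix u (K (j + 1))).drop (l (j + 1)) := by
    intro j
    rw [hlabw, ← List.drop_append_of_le_length (hK1 j), ← concatPrefix_add,
      Nat.add_sub_cancel' (hKmono j)]
    have h1 : concatPrefix U (j + 1) <+: concatPrefix u (K (j + 1)) := by
      rw [hU.prefix_eq, hlab.prefix_eq]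
      exact w.take_isPrefix (hK1 (j + 1))
    obtain ⟨r, hr⟩ := h1
    rw [← hr]
    have h2 : l (j + 1) = (concatPrefix U (j + 1)).length := rfl
    rw [h2, List.drop_left, concatPrefix_succ, List.append_assoc]
    exact List.drop_left
  have hmem : ∀ j, (p j, p (j + 1)) ∈ V.profile L (U j) := by
    intro j
    refine ⟨(t.drop (K j)).take (K (j + 1) - K j), ?_, hword j⟩
    have := steps_drop_take hrun (K j) (K (j + 1) - K j)
    rwa [Nat.add_sub_cancel' (hKmono j)] at this
  have hKlt : ∀ N, ∃ j, N ≤ K j := by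
    intro N
    obtain ⟨j, hj⟩ := hU.unbounded ((concatPrefix u N).length + 1)
    refine ⟨j, ?_⟩
    by_contra hlt
    have h1 := concatPrefix_length_mono u (show K j ≤ N by omega)
    have h2 := hK1 j
    simp only [hl] at h2
    omega
  have hmemF : ∀ N, ∃ j, N ≤ j ∧ (p j, p (j + 1)) ∈ V.finalProfile L (U j) := by
    intro N
    obtain ⟨k, hk, hkF⟩ := hfin (K N)
    obtain ⟨m, hm⟩ := hKlt (k + 1)
    -- The least such index `j` is the piece containing the final visit: `K j ≤ k < K (j + 1)`.
    have hex2 : ∃ m, k < K (m + 1) := ⟨m, by have := hKmono m; omega⟩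
    set j := Nat.find hex2 with hj
    have hj1 : k < K (j + 1) := Nat.find_spec hex2
    have hj2 : N ≤ j := by
      by_contra hlt
      have := hKm (show j + 1 ≤ N by omega)
      omega
    have hj3 : K j ≤ k := by
      rcases Nat.eq_zero_or_eq_succ_pred j with h | h
      · rw [h, hK0]; omega
      · have := Nat.find_min hex2 (show j.pred < Nat.find hex2 by omega)
        rw [h]; exact not_lt.1 this
    refine ⟨j, hj2, (t.drop (K j)).take (k - K j), (t.drop k).take (K (j + 1) - k), c k, ?_, hkF,
      ?_, ?_⟩
    · have := steps_drop_take hrun (K j) (k - K j)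
      rwa [Nat.add_sub_cancel' hj3] at this
    · have := steps_drop_take hrun k (K (j + 1) - k)
      rwa [Nat.add_sub_cancel' hj1.le] at this
    · rw [← hword j]
      congr 2
      have : K (j + 1) - K j = (k - K j) + (K (j + 1) - k) := by omega
      rw [this, Stream'.take_add, Stream'.drop_drop, Nat.add_sub_cancel' hj3]
  have hch : ∀ j, ∃ σ, V.Steps (p j).1 σ (p (j + 1)).1 ∧
      (p j).2.1 ++ labelWord σ = U' j ++ (p (j + 1)).2.1 ∧
      ((p j, p (j + 1)) ∈ V.finalProfile L (U j) →
        ∃ τ ρ b, σ = τ ++ ρ ∧ V.Steps (p j).1 τ b ∧ b.1 ∈ V.final) := by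
    intro j
    by_cases hj : (p j, p (j + 1)) ∈ V.finalProfile L (U j)
    · have hj' := hj
      rw [hF] at hj'
      obtain ⟨σ, τ, b, h1, h2, h3, h4⟩ := hj'
      exact ⟨σ ++ τ, steps_append.2 ⟨b, h1, h3⟩, h4, fun _ => ⟨σ, τ, b, rfl, h1, h2⟩⟩
    · have hj' := hmem j
      rw [h0] at hj'
      obtain ⟨σ, h1, h2⟩ := hj'
      exact ⟨σ, h1, h2, fun h => absurd h hj⟩
  choose σ hσ1 hσ2 hσ3 using hch
  have hX : ∀ j, concatPrefix (fun j => labelWord (σ j)) j = concatPrefix U' j ++ (p j).2.1 := by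
    intro j
    induction j with
    | zero => simp [hp, hK0]
    | succ j ih =>
      rw [concatPrefix_succ, ih, List.append_assoc, hσ2, concatPrefix_succ, List.append_assoc]
  have hXu : ∀ N, ∃ k, N ≤ (concatPrefix (fun j => labelWord (σ j)) k).length := by
    intro N
    obtain ⟨k, hk⟩ := hU'.unbounded N
    exact ⟨k, by rw [hX, List.length_append]; omega⟩
  have hσu : ∀ N, ∃ k, N ≤ (concatPrefix σ k).length := by
    intro N
    obtain ⟨k, hk⟩ := hXu (N * L + 1)
    refine ⟨k, ?_⟩
    by_contra hlt
    rw [show (concatPrefix (fun j => labelWord (σ j)) k) = labelWord (concatPrefix σ k) from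
      concatPrefix_flatMap _ _ _] at hk
    have h1 := length_labelWord_le (σ := concatPrefix σ k)
      fun t ht => hL t ((steps_concatPrefix hσ1 k).mem_trans t ht)
    have h2 := Nat.mul_le_mul_right L (show (concatPrefix σ k).length ≤ N by omega)
    omega
  refine mem_language_of_steps (σ := σ) (C := fun j => (p j).1) ?_ hσ1 hσu ?_ ?_
  · simp only [hp, hK0]; exact hrun.1
  · intro N
    obtain ⟨j, hj, hjF⟩ := hmemF N
    obtain ⟨τ, ρ, b, h1, h2, h3⟩ := hσ3 j hjF
    exact ⟨j, τ, ρ, b, hj, h1, h2, h3⟩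
  · refine isConcatenation_iff.2 ⟨fun k => ?_, hXu⟩
    obtain ⟨m, hm⟩ := hU'.unbounded (concatPrefix (fun j => labelWord (σ j)) k).length
    have h1 := concatPrefix_isPrefix (fun j => labelWord (σ j)) (le_max_left k m)
    have h2 : concatPrefix U' m <+: concatPrefix (fun j => labelWord (σ j)) (max k m) := by
      rw [hX]
      exact (concatPrefix_isPrefix U' (le_max_right k m)).trans (List.prefix_append _ _)
    have h3 := List.prefix_of_prefix_length_le h1 h2 hm
    have h4 := w'.take_isPrefix hm
    rw [← hU'.prefix_eq] at h4
    exact (List.prefix_of_prefix_length_le h3 h4 (by simp)).eq_of_length (by simp)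

/-- Every `ω`-regular language admits a congruence of finite index on finite words such that
replacing the factors of an infinite word by congruent ones preserves membership. -/
theorem IsOmegaRegular.exists_congruence {α : Type u} [Finite α] {R : Set (Stream' α)} (hR : IsOmegaRegular R) :
    ∃ (M : Type u) (_ : Finite M) (h : List α → M),
      (∀ u u' v v', h u = h u' → h v = h v' → h (u ++ v) = h (u' ++ v')) ∧
      ∀ (U U' : ℕ → List α) (w w' : Stream' α), (∀ j, h (U j) = h (U' j)) →
        IsConcatenation U w → IsConcatenation U' w' → w ∈ R → w' ∈ R := by
  obtain ⟨m, V, rfl⟩ := hR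
  obtain ⟨L, hL⟩ := V.exists_label_length_le
  have : Finite {r : List α // r.length ≤ L} := List.finite_length_le α L
  refine ⟨_, inferInstance, fun u => (V.profile L u, V.finalProfile L u), ?_, ?_⟩
  · intro u u' v v' h1 h2
    simp only [Prod.mk.injEq] at h1 h2 ⊢
    rw [V.profile_append hL, V.profile_append hL, V.finalProfile_append hL,
      V.finalProfile_append hL, h1.1, h1.2, h2.1, h2.2]
    exact ⟨rfl, rfl⟩
  · intro U U' w w' h hU hU' hw
    simp only [Prod.mk.injEq] at h
    exact V.mem_language_of_profiles hL (fun j => (h j).1) (fun j => (h j).2) hU hU' hw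

/-- By pigeonhole two powers of `u` have the same class; from the smaller exponent on, the classes
are periodic. -/
theorem exists_pow_congruent {M : Type*} [Finite M] (h : List α → M)
    (hh : ∀ u u' v v', h u = h u' → h v = h v' → h (u ++ v) = h (u' ++ v')) (u : List α) :
    ∃ i p, 0 < p ∧ ∀ k x, i ≤ k →
      h (List.replicate (k + x * p) u).flatten = h (List.replicate k u).flatten := by
  obtain ⟨a, b, hab, heq⟩ := Finite.exists_ne_map_eq_of_infinite
    fun k => h (List.replicate k u).flatten
  wlog hlt : a < b generalizing a b
  · exact this b a hab.symm heq.symm (by omega)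
  refine ⟨a, b - a, by omega, fun k x hk => ?_⟩
  induction x with
  | zero => simp
  | succ x ih =>
    rw [← ih]
    have h1 : k + (x + 1) * (b - a) = b + (k - a + x * (b - a)) := by
      rw [Nat.succ_mul]; omega
    have h2 : k + x * (b - a) = a + (k - a + x * (b - a)) := by omega
    rw [h1, h2, List.replicate_add, List.replicate_add a, List.flatten_append,
      List.flatten_append]
    exact hh _ _ _ _ heq.symm rfl

end Profiles

/-! ### Basic properties of Karp–Miller graphs -/

section KarpMillerBasics

variable {Q : Type*} {d : ℕ} {α : Type*}

theorem isKMPath_append {G : Set (KMEdge Q d α)} {c c' : ExtConfig Q d}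
    {p q : List (KMEdge Q d α)} :
    IsKMPath G c (p ++ q) c' ↔ ∃ b, IsKMPath G c p b ∧ IsKMPath G b q c' := by
  induction p generalizing c with
  | nil => simp [IsKMPath]
  | cons e p ih => simp [IsKMPath, ih, and_assoc]

theorem IsKMPath.mono {G H : Set (KMEdge Q d α)} (hGH : G ⊆ H) {c c' : ExtConfig Q d}
    {p : List (KMEdge Q d α)} (h : IsKMPath G c p c') : IsKMPath H c p c' := by
  induction p generalizing c with
  | nil => exact h
  | cons e p ih => exact ⟨hGH h.1, h.2.1, ih h.2.2⟩

theorem IsKMPath.mem {G : Set (KMEdge Q d α)} {c c' : ExtConfig Q d}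
    {p : List (KMEdge Q d α)} (h : IsKMPath G c p c') : ∀ e ∈ p, e ∈ G := by
  induction p generalizing c with
  | nil => simp
  | cons e p ih => simpa [h.1] using ih h.2.2

theorem IsKMPath.replicate {G : Set (KMEdge Q d α)} {c : ExtConfig Q d}
    {p : List (KMEdge Q d α)} (h : IsKMPath G c p c) (k : ℕ) :
    IsKMPath G c (List.replicate k p).flatten c := by
  induction k with
  | zero => rfl
  | succ k ih =>
    rw [List.replicate_succ, List.flatten_cons]
    exact isKMPath_append.2 ⟨c, h, ih⟩

theorem KMReach.refl (G : Set (KMEdge Q d α)) (c : ExtConfig Q d) : KMReach G c c := ⟨[], rfl⟩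

theorem KMReach.trans {G : Set (KMEdge Q d α)} {a b c : ExtConfig Q d} (h : KMReach G a b)
    (h' : KMReach G b c) : KMReach G a c := by
  obtain ⟨p, hp⟩ := h
  obtain ⟨q, hq⟩ := h'
  exact ⟨p ++ q, isKMPath_append.2 ⟨b, hp, hq⟩⟩

theorem KMReach.mono {G H : Set (KMEdge Q d α)} (hGH : G ⊆ H) {a b : ExtConfig Q d}
    (h : KMReach G a b) : KMReach H a b := by
  obtain ⟨p, hp⟩ := h
  exact ⟨p, hp.mono hGH⟩

theorem KMReach.of_mem {G : Set (KMEdge Q d α)} {e : KMEdge Q d α} (h : e ∈ G) :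
    KMReach G e.src e.tgt := ⟨[e], h, rfl, rfl⟩

/-- An edge that comes from a transition of `V`, possibly with acceleration. -/
def BuchiVASS.IsValidEdge (V : BuchiVASS Q d α) (e : KMEdge Q d α) : Prop :=
  e.label ∈ V.trans ∧ e.label.src = e.src.1 ∧ e.label.tgt = e.tgt.1 ∧
    ∃ m', IsExtSum e.src.2 e.label.effect m' ∧ ∀ i, e.tgt.2 i = m' i ∨ e.tgt.2 i = ⊤

theorem KMConstruction.isValidEdge {V : BuchiVASS Q d α} {G : Set (KMEdge Q d α)}
    (h : KMConstruction V G) : ∀ e ∈ G, V.IsValidEdge e := by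
  induction h with
  | start => simp
  | extend G c t m' hG hc ht hsrc hm hnew ih =>
    rintro e (rfl | he)
    · refine ⟨ht, hsrc, rfl, m', hm, fun i => ?_⟩
      dsimp only [accelerate]
      split_ifs <;> simp
    · exact ih e he

theorem KMConstruction.finite {V : BuchiVASS Q d α} {G : Set (KMEdge Q d α)}
    (h : KMConstruction V G) : G.Finite := by
  induction h with
  | start => exact Set.finite_empty
  | extend G c t m' hG hc ht hsrc hm hnew ih => exact ih.insert _

theorem KMConstruction.reach_src {V : BuchiVASS Q d α} {G : Set (KMEdge Q d α)}
    (h : KMConstruction V G) : ∀ e ∈ G, KMReach G V.extInit e.src := by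
  induction h with
  | start => simp
  | extend G c t m' hG hc ht hsrc hm hnew ih =>
    rintro e (rfl | he)
    · exact hc.mono (Set.subset_insert _ _)
    · exact (ih e he).mono (Set.subset_insert _ _)

/-- All sources of edges of `G` are already reachable, so continuing after the new edge along old
ones discovers nothing further. -/
theorem KMReach.of_insert {G : Set (KMEdge Q d α)} {c₀ v : ExtConfig Q d} {e : KMEdge Q d α}
    (hG : ∀ e ∈ G, KMReach G c₀ e.src) (h : KMReach (insert e G) c₀ v) :
    KMReach G c₀ v ∨ v = e.tgt := by
  obtain ⟨p, hp⟩ := h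
  have key : ∀ p a, (KMReach G c₀ a ∨ a = e.tgt) → IsKMPath (insert e G) a p v →
      (KMReach G c₀ v ∨ v = e.tgt) := by
    intro p
    induction p with
    | nil => rintro a ha rfl; exact ha
    | cons f p ih =>
      rintro a ha ⟨hf | hf, h2, h3⟩
      · exact ih f.tgt (Or.inr (by rw [hf])) h3
      · exact ih f.tgt (Or.inl ((hG f hf).trans (KMReach.of_mem hf))) h3
  exact key p c₀ (Or.inl (KMReach.refl _ _)) hp

/-! ### Counter effects of paths, and firing paths as runs -/

theorem counterEffect_nil : counterEffect ([] : List (KMEdge Q d α)) = 0 := rfl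

theorem counterEffect_cons (e : KMEdge Q d α) (p : List (KMEdge Q d α)) :
    counterEffect (e :: p) = e.label.effect + counterEffect p := by
  simp [counterEffect]

theorem counterEffect_append (p q : List (KMEdge Q d α)) :
    counterEffect (p ++ q) = counterEffect p + counterEffect q := by
  simp [counterEffect]

theorem counterEffect_replicate (p : List (KMEdge Q d α)) (k : ℕ) :
    counterEffect (List.replicate k p).flatten = k • counterEffect p := by
  induction k with
  | zero => simp [counterEffect]
  | succ k ih =>
    rw [List.replicate_succ, List.flatten_cons, counterEffect_append, ih, succ_nsmul']

/-- A bound on how far any counter can drop along an edge sequence. -/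
def counterDrain (p : List (KMEdge Q d α)) : ℕ :=
  (p.map fun e => ∑ i, (e.label.effect i).natAbs).sum

theorem counterDrain_cons (e : KMEdge Q d α) (p : List (KMEdge Q d α)) :
    counterDrain (e :: p) = ∑ i, (e.label.effect i).natAbs + counterDrain p := by
  simp [counterDrain]

theorem natAbs_effect_le_sum (δ : Fin d → ℤ) (i : Fin d) : (δ i).natAbs ≤ ∑ i, (δ i).natAbs :=
  Finset.single_le_sum (f := fun i => (δ i).natAbs) (fun _ _ => Nat.zero_le _)
    (Finset.mem_univ i)

theorem neg_counterDrain_le (p : List (KMEdge Q d α)) (i : Fin d) :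
    -(counterDrain p : ℤ) ≤ counterEffect p i := by
  induction p with
  | nil => simp [counterDrain, counterEffect]
  | cons e p ih =>
    have := natAbs_effect_le_sum e.label.effect i
    rw [counterDrain_cons, counterEffect_cons, Pi.add_apply]
    omega

/-- The transitions along an edge sequence. -/
abbrev pathTransitions (p : List (KMEdge Q d α)) : List (VASSTransition Q d α) :=
  p.map KMEdge.label

theorem BuchiVASS.IsValidEdge.counter {V : BuchiVASS Q d α} {e : KMEdge Q d α}
    (h : V.IsValidEdge e) (i : Fin d) :
    e.tgt.2 i = ⊤ ∨ ∃ a b : ℕ, e.src.2 i = a ∧ e.tgt.2 i = b ∧ (b : ℤ) = a + e.label.effect i := by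
  obtain ⟨-, -, -, m', hm, hi⟩ := h
  rcases hi i with h1 | h1
  · rcases hm i with ⟨-, h2⟩ | ⟨a, b, h2, h3, h4⟩
    · exact Or.inl (h1.trans h2)
    · exact Or.inr ⟨a, b, h2, h1.trans h3, h4⟩
  · exact Or.inl h1

theorem BuchiVASS.IsValidEdge.top {V : BuchiVASS Q d α} {e : KMEdge Q d α}
    (h : V.IsValidEdge e) {i : Fin d} (hi : e.src.2 i = ⊤) : e.tgt.2 i = ⊤ := by
  rcases h.counter i with h1 | ⟨a, b, h1, -⟩
  · exact h1
  · rw [hi] at h1; exact absurd h1 (ENat.top_ne_natCast a)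

/-- The value `ω` is never lost along a path. A counter finite at the end was therefore finite
throughout, never accelerated, and changed exactly by the effect. -/
theorem IsKMPath.counter {V : BuchiVASS Q d α} {G : Set (KMEdge Q d α)}
    (hG : ∀ e ∈ G, V.IsValidEdge e) {c c' : ExtConfig Q d} {p : List (KMEdge Q d α)}
    (h : IsKMPath G c p c') (i : Fin d) :
    c'.2 i = ⊤ ∨ ∃ a b : ℕ, c.2 i = a ∧ c'.2 i = b ∧ (b : ℤ) = a + counterEffect p i := by
  induction p generalizing c with
  | nil =>
    obtain rfl : c = c' := h
    by_cases hc : c.2 i = ⊤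
    · exact Or.inl hc
    · obtain ⟨a, ha⟩ := ENat.ne_top_iff_exists.1 hc
      exact Or.inr ⟨a, a, ha.symm, ha.symm, by simp [counterEffect]⟩
  | cons e p ih =>
    obtain ⟨he, rfl, hp⟩ := h
    rcases ih hp with h1 | ⟨a, b, h1, h2, h3⟩
    · exact Or.inl h1
    · rcases (hG e he).counter i with h4 | ⟨a', b', h4, h5, h6⟩
      · rw [h4] at h1; exact absurd h1 (ENat.top_ne_natCast a)
      · rw [h5] at h1
        have : b' = a := by exact_mod_cast h1
        refine Or.inr ⟨a', b, h4, h2, ?_⟩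
        rw [counterEffect_cons, Pi.add_apply]
        omega

/-- Counters that are finite at the end are tracked exactly, so starting above them suffices; every
other counter starts above the total amount the path could drain. -/
theorem IsKMPath.steps {V : BuchiVASS Q d α} {G : Set (KMEdge Q d α)}
    (hG : ∀ e ∈ G, V.IsValidEdge e) {c c' : ExtConfig Q d} {p : List (KMEdge Q d α)}
    (h : IsKMPath G c p c') (x : Fin d → ℕ) (hfin : ∀ i, c'.2 i ≠ ⊤ → c.2 i ≤ x i)
    (htop : ∀ i, c'.2 i = ⊤ → counterDrain p ≤ x i) :
    ∃ x' : Fin d → ℕ, V.Steps (c.1, x) (pathTransitions p) (c'.1, x') ∧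
      ∀ i, (x' i : ℤ) = x i + counterEffect p i := by
  induction p generalizing c x with
  | nil =>
    obtain rfl : c = c' := h
    exact ⟨x, rfl, by simp [counterEffect]⟩
  | cons e p ih =>
    obtain ⟨he, rfl, hp⟩ := h
    have hv := hG e he
    have hfin' : ∀ i, c'.2 i ≠ ⊤ → ∃ b : ℕ, e.tgt.2 i = b ∧ (b : ℤ) ≤ x i + e.label.effect i := by
      intro i hi
      have h1 := hfin i hi
      rcases hp.counter hG i with h2 | ⟨a, b, h2, -⟩
      · exact absurd h2 hi
      rcases hv.counter i with h3 | ⟨a', b', h3, h4, h5⟩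
      · rw [h3] at h2; exact absurd h2 (ENat.top_ne_natCast a)
      · rw [h3] at h1
        have : a' ≤ x i := by exact_mod_cast h1
        exact ⟨b', h4, by omega⟩
    have hnn : ∀ i, 0 ≤ (x i : ℤ) + e.label.effect i := by
      intro i
      by_cases hi : c'.2 i = ⊤
      · have h1 := htop i hi
        have h2 := natAbs_effect_le_sum e.label.effect i
        rw [counterDrain_cons] at h1
        omega
      · obtain ⟨b, -, hb⟩ := hfin' i hi
        omega
    obtain ⟨x', hx', hx''⟩ := ih hp (fun i => ((x i : ℤ) + e.label.effect i).toNat)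
      (fun i hi => by
        obtain ⟨b, hb, hb'⟩ := hfin' i hi
        rw [hb]
        exact_mod_cast (show b ≤ ((x i : ℤ) + e.label.effect i).toNat by omega))
      (fun i hi => by
        have h1 := htop i hi
        have h2 := natAbs_effect_le_sum e.label.effect i
        rw [counterDrain_cons] at h1
        omega)
    refine ⟨x', ⟨hv.1, hv.2.1, _, fun i => Int.toNat_of_nonneg (hnn i), ?_⟩, fun i => ?_⟩
    · rw [hv.2.2.1]; exact hx'
    · rw [hx'', Int.toNat_of_nonneg (hnn i), counterEffect_cons, Pi.add_apply]
      ring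

/-- Repeating a path that returns to the same state with at least the same counter values. -/
theorem IsKMPath.steps_repeat {V : BuchiVASS Q d α} {G : Set (KMEdge Q d α)}
    (hG : ∀ e ∈ G, V.IsValidEdge e) {q : Q} {m m' : Fin d → ℕ∞} (hm : m ≤ m')
    {p : List (KMEdge Q d α)} (h : IsKMPath G (q, m) p (q, m')) (r : ℕ) (x : Fin d → ℕ)
    (hfin : ∀ i, m' i ≠ ⊤ → m i ≤ x i) (htop : ∀ i, m' i = ⊤ → r * counterDrain p ≤ x i) :
    ∃ σ, ∃ x' : Fin d → ℕ, V.Steps (q, x) σ (q, x') ∧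
      ∀ i, (x' i : ℤ) = x i + r * counterEffect p i := by
  induction r generalizing x with
  | zero => exact ⟨[], x, rfl, by simp⟩
  | succ r ih =>
    obtain ⟨y, hy, hy'⟩ := h.steps hG x hfin fun i hi => by
      have := htop i hi; rw [Nat.succ_mul] at this; omega
    obtain ⟨σ, x', hx, hx'⟩ := ih y
      (fun i hi => by
        have h1 := hfin i hi
        rcases h.counter hG i with h2 | ⟨a, b, h2, h3, h4⟩
        · exact absurd h2 hi
        · have h5 := hm i
          dsimp only at h2 h3
          rw [h2] at h1 ⊢
          rw [h2, h3] at h5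
          have h6 : a ≤ x i := by exact_mod_cast h1
          have h7 : a ≤ b := ENat.natCast_le_natCast.1 h5
          have h8 := hy' i
          exact_mod_cast (show a ≤ y i by omega))
      (fun i hi => by
        have h1 := htop i hi
        have h2 := neg_counterDrain_le p i
        have h3 := hy' i
        rw [Nat.succ_mul] at h1
        omega)
    refine ⟨_, x', BuchiVASS.steps_append.2 ⟨_, hy, hx⟩, fun i => ?_⟩
    rw [hx', hy']
    push_cast
    ring

/-- The node represents reachable configurations: finite entries are attained exactly while all
`ω`-entries are simultaneously at least `k`. For a newly accelerated node, the paths that justify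
the acceleration are repeated. -/
theorem KMConstruction.coverable {V : BuchiVASS Q d α} {G : Set (KMEdge Q d α)}
    (h : KMConstruction V G) {c : ExtConfig Q d} (hc : KMReach G V.extInit c) (k : ℕ) :
    ∃ σ, ∃ x : Fin d → ℕ, V.Steps (V.init, 0) σ (c.1, x) ∧
      ∀ i, c.2 i = x i ∨ (c.2 i = ⊤ ∧ k ≤ x i) := by
  induction h generalizing c k with
  | start =>
    obtain ⟨p, hp⟩ := hc
    cases p with
    | nil =>
      obtain rfl : V.extInit = c := hp
      exact ⟨[], 0, rfl, fun i => Or.inl rfl⟩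
    | cons e p => exact absurd hp.1 (Set.notMem_empty e)
  | extend G c₁ t m' hG hc₁ ht hsrc hm hnew ih =>
    rcases hc.of_insert hG.reach_src with hc | rfl
    · exact ih hc k
    -- The new edge is replaced by its unaccelerated version, so that the repeated paths end in `m'`
    -- and still track the counters about to be raised.
    have hV' : ∀ e ∈ insert (⟨c₁, t, (t.tgt, m')⟩ : KMEdge Q d α) G, V.IsValidEdge e := by
      rintro e (rfl | he)
      · exact ⟨ht, hsrc, rfl, m', hm, fun i => Or.inl rfl⟩
      · exact hG.isValidEdge e he
    let acc : Fin d → Prop := fun i => ∃ m₁ : Fin d → ℕ∞, KMReach G V.extInit (t.tgt, m₁) ∧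
      KMReach G (t.tgt, m₁) c₁ ∧ m₁ ≤ m' ∧ m₁ i < m' i
    -- Accelerated coordinates are pumped one at a time; `s` holds those already treated. The order
    -- does not matter: a pumping path goes from `m₁ ≤ m'` to `m'`, so it decreases no coordinate
    -- that is finite in `m'`.
    have key : ∀ (s : Finset (Fin d)) (k : ℕ), ∃ σ, ∃ x : Fin d → ℕ,
        V.Steps (V.init, 0) σ (t.tgt, x) ∧ ∀ i, (m' i = ⊤ → k ≤ x i) ∧
          (m' i ≠ ⊤ → m' i ≤ x i ∧ (¬ acc i → m' i = x i) ∧ (i ∈ s → acc i → k ≤ x i)) := by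
      intro s
      induction s using Finset.induction_on with
      | empty =>
        intro k
        obtain ⟨σ, x, hσ, hx⟩ := ih hc₁ (k + ∑ i, (t.effect i).natAbs)
        have hpath : IsKMPath (insert (⟨c₁, t, (t.tgt, m')⟩ : KMEdge Q d α) G) c₁
            [⟨c₁, t, (t.tgt, m')⟩] (t.tgt, m') := ⟨Set.mem_insert _ _, rfl, rfl⟩
        obtain ⟨x', hx1, hx2⟩ := hpath.steps hV' x
          (fun i hi => by
            rcases hx i with h1 | h1
            · exact h1.le
            · rcases hm i with h2 | ⟨a, b, h2, -⟩
              · exact absurd h2.2 hi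
              · rw [h1.1] at h2; exact absurd h2 (ENat.top_ne_natCast a))
          (fun i hi => by
            rcases hm i with h2 | ⟨a, b, h2, h3, -⟩
            · rcases hx i with h1 | h1
              · rw [h2.1] at h1; exact absurd h1 (ENat.top_ne_natCast _)
              · simp only [counterDrain, List.map_cons, List.map_nil, List.sum_cons, List.sum_nil]
                omega
            · dsimp only at hi
              rw [h3] at hi; exact absurd hi (ENat.natCast_ne_top _))
        refine ⟨_, x', BuchiVASS.steps_append.2 ⟨_, hσ, hx1⟩, fun i => ?_⟩
        have h5 := hx2 i
        rw [counterEffect_cons, counterEffect_nil, add_zero] at h5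
        rcases hm i with h2 | ⟨a, b, h2, h3, h4⟩
        · refine ⟨fun _ => ?_, fun h => absurd h2.2 h⟩
          rcases hx i with h1 | h1
          · rw [h2.1] at h1; exact absurd h1 (ENat.top_ne_natCast _)
          · have := natAbs_effect_le_sum t.effect i
            dsimp only at h5
            omega
        · refine ⟨fun h => ?_, fun _ => ?_⟩
          · rw [h3] at h; exact absurd h (ENat.natCast_ne_top _)
          · have h6 : m' i = x' i := by
              rcases hx i with h1 | h1
              · rw [h2] at h1
                have h7 : a = x i := by exact_mod_cast h1
                dsimp only at h5
                rw [h3]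
                exact_mod_cast (show b = x' i by omega)
              · rw [h1.1] at h2; exact absurd h2 (ENat.top_ne_natCast a)
            exact ⟨h6.le, fun _ => h6, fun h => absurd h (Finset.notMem_empty i)⟩
      | insert i₀ s hi₀ ihs =>
        intro k
        by_cases hacc : acc i₀ ∧ m' i₀ ≠ ⊤
        · obtain ⟨⟨m₁, hm₁, ⟨p, hp⟩, hle, hlt⟩, htop⟩ := hacc
          have hpath : IsKMPath (insert (⟨c₁, t, (t.tgt, m')⟩ : KMEdge Q d α) G) (t.tgt, m₁)
              (p ++ [⟨c₁, t, (t.tgt, m')⟩]) (t.tgt, m') :=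
            isKMPath_append.2 ⟨c₁, hp.mono (Set.subset_insert _ _), Set.mem_insert _ _, rfl, rfl⟩
          obtain ⟨p', hp'⟩ : ∃ p', p' = p ++ [⟨c₁, t, (t.tgt, m')⟩] := ⟨_, rfl⟩
          rw [← hp'] at hpath
          -- Enough for `k` repetitions of `p'` to leave at least `k` in each counter that is `ω` in
          -- `m'`.
          obtain ⟨σ, x, hσ, hx⟩ := ihs (k + k * counterDrain p')
          obtain ⟨τ, x', hτ, hx'⟩ := hpath.steps_repeat hV' hle k x
            (fun i hi => (hle i).trans ((hx i).2 hi).1)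
            (fun i hi => by have := (hx i).1 hi; omega)
          refine ⟨_, x', BuchiVASS.steps_append.2 ⟨_, hσ, hτ⟩, fun i => ⟨fun hi => ?_,
            fun hi => ?_⟩⟩
          · have h1 := (hx i).1 hi
            have h2 := neg_counterDrain_le p' i
            have h3 := hx' i
            have h4 : (k : ℤ) * -(counterDrain p') ≤ k * counterEffect p' i :=
              mul_le_mul_of_nonneg_left h2 (by positivity)
            have h5 : (k : ℤ) + k * counterDrain p' ≤ x i := by exact_mod_cast h1
            have : (k : ℤ) ≤ x' i := by linarith
            exact_mod_cast this
          · obtain ⟨h1, h2, h3⟩ := (hx i).2 hi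
            rcases hpath.counter hV' i with h4 | ⟨a, b, h4, h5, h6⟩
            · exact absurd h4 hi
            dsimp only at h4 h5
            have h7 : a ≤ b := by
              have := hle i; rw [h4, h5] at this; exact ENat.natCast_le_natCast.1 this
            have h8 := hx' i
            have h9 : 0 ≤ (k : ℤ) * counterEffect p' i :=
              mul_nonneg (by positivity) (by omega)
            have h10 : x i ≤ x' i := by omega
            refine ⟨h1.trans (by exact_mod_cast h10), fun hi' => ?_, fun his hi' => ?_⟩
            -- A non-zero effect would be positive here, and the same `m₁` would then accelerate
            -- `i`.
            · have h11 : counterEffect p' i = 0 := by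
                by_contra hne
                refine hi' ⟨m₁, hm₁, ⟨p, hp⟩, hle, ?_⟩
                rw [h4, h5]
                exact_mod_cast (show a < b by omega)
              rw [h11, mul_zero, add_zero] at h8
              rw [h2 hi']
              exact_mod_cast h8.symm
            · rcases Finset.mem_insert.1 his with rfl | his
              · have h11 : a < b := by rw [h4, h5] at hlt; exact_mod_cast hlt
                have h12 : (k : ℤ) * 1 ≤ k * counterEffect p' i :=
                  mul_le_mul_of_nonneg_left (by omega) (by positivity)
                omega
              · have := h3 his hi'
                have h13 : k ≤ k + k * counterDrain p' := Nat.le_add_right _ _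
                omega
        · obtain ⟨σ, x, hσ, hx⟩ := ihs k
          refine ⟨σ, x, hσ, fun i => ⟨(hx i).1, fun hi => ⟨((hx i).2 hi).1, ((hx i).2 hi).2.1,
            fun his hi' => ?_⟩⟩⟩
          rcases Finset.mem_insert.1 his with rfl | his
          · exact absurd ⟨hi', hi⟩ hacc
          · exact ((hx i).2 hi).2.2 his hi'
    obtain ⟨σ, x, hσ, hx⟩ := key Finset.univ k
    refine ⟨σ, x, hσ, fun i => ?_⟩
    by_cases hi : acc i
    · have h1 : accelerate V G c₁ t.tgt m' i = ⊤ := if_pos hi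
      refine Or.inr ⟨h1, ?_⟩
      by_cases hi' : m' i = ⊤
      · exact (hx i).1 hi'
      · exact ((hx i).2 hi').2.2 (Finset.mem_univ i) hi
    · have h1 : accelerate V G c₁ t.tgt m' i = m' i := if_neg hi
      dsimp only
      rw [h1]
      by_cases hi' : m' i = ⊤
      · exact Or.inr ⟨hi', (hx i).1 hi'⟩
      · exact Or.inl (((hx i).2 hi').2.1 hi)

/-- The extended configuration `c` over-approximates the configuration `x`. -/
def ExtConfig.Covers (c : ExtConfig Q d) (x : Q × (Fin d → ℕ)) : Prop :=
  c.1 = x.1 ∧ ∀ i, c.2 i = ⊤ ∨ c.2 i = x.2 i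

theorem IsKarpMillerGraph.exists_edge {V : BuchiVASS Q d α} {G : Set (KMEdge Q d α)}
    (hG : IsKarpMillerGraph V G) {c : ExtConfig Q d} {x x' : Q × (Fin d → ℕ)}
    {t : VASSTransition Q d α} (hc : KMReach G V.extInit c) (hcx : c.Covers x)
    (ht : t ∈ V.trans) (hsrc : t.src = x.1) (htgt : t.tgt = x'.1)
    (heff : ∀ i, (x'.2 i : ℤ) = x.2 i + t.effect i) :
    ∃ e ∈ G, e.src = c ∧ e.label = t ∧ e.tgt.Covers x' := by
  obtain ⟨e, he, rfl, rfl⟩ := hG.2 c t (fun i => if c.2 i = ⊤ then ⊤ else x'.2 i) hc ht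
    (hsrc.trans hcx.1.symm) (fun i => by
      by_cases hi : c.2 i = ⊤
      · exact Or.inl ⟨hi, if_pos hi⟩
      · exact Or.inr ⟨x.2 i, x'.2 i, (hcx.2 i).resolve_left hi, if_neg hi, heff i⟩)
  refine ⟨e, he, rfl, rfl, (hG.1.isValidEdge e he).2.2.1.symm.trans htgt, fun i => ?_⟩
  rcases (hG.1.isValidEdge e he).counter i with h1 | ⟨a, b, h1, h2, h3⟩
  · exact Or.inl h1
  · rcases hcx.2 i with h4 | h4
    · rw [h4] at h1; exact absurd h1 (ENat.top_ne_natCast a)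
    · rw [h1] at h4
      have h5 : a = x.2 i := by exact_mod_cast h4
      have h6 := heff i
      rw [h2]
      exact Or.inr (by exact_mod_cast (show b = x'.2 i by omega))

end KarpMillerBasics

/-! ### The Karp–Miller construction terminates -/

section Termination

variable {Q : Type*} {d : ℕ} {α : Type*}

theorem IsKMPath.eq_or_exists_tgt {G : Set (KMEdge Q d α)} {a c : ExtConfig Q d}
    {p : List (KMEdge Q d α)} (h : IsKMPath G a p c) : c = a ∨ ∃ e ∈ G, e.tgt = c := by
  induction p generalizing a with
  | nil => exact Or.inl h.symm
  | cons e p ih =>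
    rcases ih h.2.2 with h1 | h1
    · exact Or.inr ⟨e, h.1, h1.symm⟩
    · exact Or.inr h1

/-- A finitely branching forest on `ℕ` with finitely many roots has an infinite branch. -/
theorem exists_infinite_branch (R : ℕ → ℕ → Prop) (root : Set ℕ) (hroot : root.Finite)
    (hfin : ∀ j, {k | R k j}.Finite) (hlt : ∀ j k, R k j → j < k)
    (hpar : ∀ k, k ∈ root ∨ ∃ j, R k j) : ∃ f : ℕ → ℕ, ∀ i, R (f (i + 1)) (f i) := by
  by_contra hno
  have hwf : WellFounded R := by
    rw [wellFounded_iff_isEmpty_descending_chain]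
    exact ⟨fun f => hno ⟨f.1, f.2⟩⟩
  have hD : ∀ j, {k | Relation.ReflTransGen (fun a b => R b a) j k}.Finite := by
    intro j
    induction j using hwf.induction with
    | _ j ih =>
      refine ((Set.finite_singleton j).union ((hfin j).biUnion ih)).subset ?_
      intro k hk
      rcases Relation.ReflTransGen.cases_head hk with h | ⟨l, hl, hlk⟩
      · exact Or.inl h.symm
      · exact Or.inr (Set.mem_biUnion (show l ∈ {k | R k j} from hl) hlk)
  refine Set.infinite_univ ((hroot.biUnion fun j _ => hD j).subset fun k _ => ?_)
  induction k using Nat.strong_induction_on with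
  | _ k ih =>
    rcases hpar k with h | ⟨j, hj⟩
    · exact Set.mem_biUnion h Relation.ReflTransGen.refl
    · obtain ⟨r, hr, hrj⟩ := Set.mem_iUnion₂.1 (ih j (hlt j k hj) (Set.mem_univ _))
      exact Set.mem_biUnion hr (Relation.ReflTransGen.tail hrj hj)

/-- If the construction never stopped, König's lemma would give an infinite path of pairwise
distinct nodes. Eventually its set of `ω`-coordinates is constant, yet a well-quasi-order argument
finds a later node strictly above an earlier one with the same state, which forces a new `ω`. -/
theorem exists_isKarpMillerGraph [Finite Q] (V : BuchiVASS Q d α) :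
    ∃ G, IsKarpMillerGraph V G := by
  classical
  by_contra hno
  have hstep : ∀ G : {G // KMConstruction V G}, ∃ (c : ExtConfig Q d) (t : VASSTransition Q d α)
      (m' : Fin d → ℕ∞), KMReach G.1 V.extInit c ∧ t ∈ V.trans ∧ t.src = c.1 ∧
      IsExtSum c.2 t.effect m' ∧ ∀ e ∈ G.1, ¬ (e.src = c ∧ e.label = t) := by
    rintro ⟨G, hG⟩
    by_contra h
    refine hno ⟨G, hG, fun c t m' h1 h2 h3 h4 => ?_⟩
    by_contra h5
    exact h ⟨c, t, m', h1, h2, h3, h4, fun e he h6 => h5 ⟨e, he, h6⟩⟩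
  choose c t m' hc ht hsrc hm hnew using hstep
  let edge : {G // KMConstruction V G} → KMEdge Q d α := fun G =>
    ⟨c G, t G, ((t G).tgt, accelerate V G.1 (c G) (t G).tgt (m' G))⟩
  let S : ℕ → {G // KMConstruction V G} := fun k => Nat.rec ⟨∅, KMConstruction.start⟩
    (fun _ G => ⟨insert (edge G) G.1,
      KMConstruction.extend G.1 (c G) (t G) (m' G) G.2 (hc G) (ht G) (hsrc G) (hm G) (hnew G)⟩) k
  let E : ℕ → KMEdge Q d α := fun k => edge (S k)
  have hS : ∀ k, (S (k + 1)).1 = insert (E k) (S k).1 := fun k => rfl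
  have hmem : ∀ k e, e ∈ (S k).1 ↔ ∃ j < k, e = E j := by
    intro k
    induction k with
    | zero => intro e; simp [S]
    | succ k ih =>
      intro e
      rw [hS, Set.mem_insert_iff, ih]
      constructor
      · rintro (h | ⟨j, hj, h⟩)
        · exact ⟨k, by omega, h⟩
        · exact ⟨j, by omega, h⟩
      · rintro ⟨j, hj, h⟩
        rcases Nat.lt_succ_iff_lt_or_eq.1 hj with h1 | rfl
        · exact Or.inr ⟨j, h1, h⟩
        · exact Or.inl h
  have hmono : ∀ {j k}, j ≤ k → (S j).1 ⊆ (S k).1 := by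
    intro j k hjk e he
    obtain ⟨i, hi, h⟩ := (hmem j e).1 he
    exact (hmem k e).2 ⟨i, by omega, h⟩
  have hEmem : ∀ {j k}, j < k → E j ∈ (S k).1 := fun {j k} h => (hmem k _).2 ⟨j, h, rfl⟩
  have hreach : ∀ k, KMReach (S k).1 V.extInit (E k).src := fun k => hc (S k)
  have hdist : ∀ j k, j < k → ¬ ((E j).src = (E k).src ∧ (E j).label = (E k).label) :=
    fun j k h => hnew (S k) (E j) (hEmem h)
  have hvalid : ∀ k, V.IsValidEdge (E k) := fun k =>
    (S (k + 1)).2.isValidEdge _ (hEmem (Nat.lt_succ_self k))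
  -- The parent of edge `k` is the first edge ever to enter its source; taking the first one makes
  -- the nodes along a branch distinct.
  let R : ℕ → ℕ → Prop := fun k j => j < k ∧ (E j).tgt = (E k).src ∧
    ∀ i < j, (E i).tgt ≠ (E k).src
  have hsrcfin : ∀ v, {k | (E k).src = v}.Finite := by
    intro v
    refine Set.Finite.of_finite_image (f := fun k => (E k).label)
      (V.finite_trans.subset ?_) ?_
    · rintro _ ⟨k, -, rfl⟩
      exact ht (S k)
    · intro j hj k hk hjk
      rcases lt_trichotomy j k with h | h | h
      · exact absurd ⟨hj.trans hk.symm, hjk⟩ (hdist j k h)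
      · exact h
      · exact absurd ⟨hk.trans hj.symm, hjk.symm⟩ (hdist k j h)
  obtain ⟨f, hf⟩ := exists_infinite_branch R {k | (E k).src = V.extInit} (hsrcfin _)
    (fun j => (hsrcfin (E j).tgt).subset fun k hk => hk.2.1.symm) (fun j k h => h.1) (fun k => by
      obtain ⟨p, hp⟩ := hreach k
      rcases hp.eq_or_exists_tgt with h | ⟨e, he, h⟩
      · exact Or.inl h
      · obtain ⟨j, hj, rfl⟩ := (hmem k e).1 he
        have hex : ∃ j, (E j).tgt = (E k).src := ⟨j, h⟩
        exact Or.inr ⟨Nat.find hex, (Nat.find_min' hex h).trans_lt hj, Nat.find_spec hex,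
          fun i hi => Nat.find_min hex hi⟩)
  let N : ℕ → ExtConfig Q d := fun i => (E (f i)).tgt
  have hNsrc : ∀ i, (E (f (i + 1))).src = N i := fun i => (hf i).2.1.symm
  have hfmono : StrictMono f := strictMono_nat_of_lt_succ fun i => (hf i).1
  have hNne : ∀ i j, i < j → N i ≠ N j := fun i j hij h =>
    (hf j).2.2 (f i) (hfmono hij) (h.trans (hf j).2.1)
  have hNreach : ∀ i l, KMReach (S (f (i + l + 1))).1 (N i) (E (f (i + l + 1))).src := by
    intro i l
    induction l with
    | zero => rw [Nat.add_zero, hNsrc]; exact KMReach.refl _ _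
    | succ l ih =>
      rw [hNsrc (i + (l + 1))]
      refine (ih.mono (hmono (hfmono (by omega)).le)).trans (KMReach.of_mem ?_)
      exact hEmem (hfmono (by omega))
  have hNinit : ∀ i j, i < j → KMReach (S (f j)).1 V.extInit (N i) := fun i j hij =>
    ((hreach (f i)).mono (hmono (hfmono hij).le)).trans (KMReach.of_mem (hEmem (hfmono hij)))
  have htop : ∀ i x, (N i).2 x = ⊤ → (N (i + 1)).2 x = ⊤ := fun i x h =>
    (hvalid (f (i + 1))).top (by rw [hNsrc]; exact h)
  obtain ⟨n, hn⟩ := WellFoundedGT.monotone_chain_condition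
    (⟨fun i => {x | (N i).2 x = ⊤}, monotone_nat_of_le_succ fun i x h => htop i x h⟩ :
      ℕ →o Set (Fin d))
  have hn' : ∀ i x, n ≤ i → (N i).2 x = ⊤ → (N n).2 x = ⊤ := fun i x hi h =>
    Set.ext_iff.1 (hn i hi) x |>.2 h
  have hn'' : ∀ i x, n ≤ i → (N n).2 x = ⊤ → (N i).2 x = ⊤ := fun i x hi h =>
    Set.ext_iff.1 (hn i hi) x |>.1 h
  obtain ⟨i, j, hij, hq, hle⟩ := ((Finite.wellQuasiOrdered (Eq : Q → Q → Prop)).prod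
    (wellQuasiOrdered_le (α := Fin d → ℕ∞))) fun i => N (n + 1 + i)
  obtain ⟨l, rfl⟩ : ∃ l, j = i + l + 1 := ⟨j - i - 1, by omega⟩
  set a := n + 1 + i with ha
  have hb : n + 1 + (i + l + 1) = a + l + 1 := by omega
  rw [hb] at hle hq
  set b := a + l + 1 with hb'
  have hba : (E (f b)).src = N (a + l) := hNsrc _
  -- After stage `n` no coordinate becomes `ω`, so this edge changed nothing by acceleration.
  have hb2 : (N b).2 = m' (S (f b)) := by
    funext x
    have h1 : (N b).2 x = accelerate V (S (f b)).1 (c (S (f b))) (t (S (f b))).tgt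
      (m' (S (f b))) x := rfl
    by_cases hx : (N b).2 x = ⊤
    · have h2 : (N (a + l)).2 x = ⊤ := hn'' _ x (by omega) (hn' b x (by omega) hx)
      rcases hm (S (f b)) x with h3 | ⟨a', b', h3, -⟩
      · rw [hx, h3.2]
      · rw [show c (S (f b)) = N (a + l) from hba, h2] at h3
        exact absurd h3 (ENat.top_ne_natCast _)
    · unfold accelerate at h1
      split_ifs at h1 with h3
      · exact absurd h1 hx
      · exact h1
  have hne : (N a).2 ≠ (N b).2 := fun h => hNne a b (by omega) (Prod.ext hq h)
  obtain ⟨x, hx⟩ := Function.ne_iff.1 hne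
  have hlt : (N a).2 x < m' (S (f b)) x := by
    rw [← hb2]; exact lt_of_le_of_ne (hle x) hx
  have hbtop : (N b).2 x = ⊤ := by
    refine if_pos ⟨(N a).2, ?_, ?_, hb2 ▸ hle, hlt⟩
    · rw [show ((t (S (f b))).tgt, (N a).2) = N a from Prod.ext hq.symm rfl]
      exact hNinit a b (by omega)
    · rw [show ((t (S (f b))).tgt, (N a).2) = N a from Prod.ext hq.symm rfl]
      exact hNreach a l
  have := hn'' a x (by omega) (hn' b x (by omega) hbtop)
  rw [this] at hlt
  exact absurd hlt not_top_lt

end Termination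

/-! ### Farkas' lemma and circulations -/

section Farkas

/-- Farkas' lemma by induction on the number of constraints. If the constraint `f j` is needed, some
`x` satisfies the others with `g x > 0`, hence `f j x > 0`. Projecting along `x` onto the kernel of
`f j` eliminates this constraint, and the coefficient of `f j` is then determined by evaluating at
`x`. -/
theorem exists_nonneg_combination_of_implies {W ι : Type*} [AddCommGroup W] [Module ℚ W]
    (f : ι → W →ₗ[ℚ] ℚ) (s : Finset ι) (g : W →ₗ[ℚ] ℚ)
    (h : ∀ x, (∀ i ∈ s, f i x ≤ 0) → g x ≤ 0) :
    ∃ l : ι → ℚ, (∀ i, 0 ≤ l i) ∧ g = ∑ i ∈ s, l i • f i := by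
  classical
  induction s using Finset.induction_on generalizing f g with
  | empty =>
    refine ⟨0, fun _ => le_rfl, LinearMap.ext fun x => ?_⟩
    have h1 := h x (by simp)
    have h2 := h (-x) (by simp)
    rw [map_neg] at h2
    simp only [Finset.sum_empty, LinearMap.zero_apply]
    linarith
  | insert j s hj ih =>
    by_cases hs : ∀ x, (∀ i ∈ s, f i x ≤ 0) → g x ≤ 0
    · obtain ⟨l, hl, hg⟩ := ih f g hs
      refine ⟨Function.update l j 0, fun i => ?_, ?_⟩
      · rcases eq_or_ne i j with rfl | hi
        · simp
        · simpa [hi] using hl i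
      · rw [Finset.sum_insert hj, Function.update_self, zero_smul, zero_add, hg]
        refine Finset.sum_congr rfl fun i hi => ?_
        rw [Function.update_of_ne (ne_of_mem_of_not_mem hi hj)]
    · push Not at hs
      obtain ⟨x, hx, hgx⟩ := hs
      have hjx : 0 < f j x := by
        by_contra hle
        exact absurd (h x fun i hi => by
          rcases Finset.mem_insert.1 hi with rfl | hi
          · exact not_lt.1 hle
          · exact hx i hi) (not_le.2 hgx)
      obtain ⟨l, hl, hg⟩ := ih (fun i => f i - (f i x / f j x) • f j) (g - (g x / f j x) • f j)
        fun z hz => by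
          have key : ∀ k : W →ₗ[ℚ] ℚ, k (z - (f j z / f j x) • x) =
              (k - (k x / f j x) • f j) z := by
            intro k
            simp only [map_sub, map_smul, LinearMap.sub_apply, LinearMap.smul_apply, smul_eq_mul]
            ring
          rw [← key]
          refine h _ fun i hi => ?_
          rcases Finset.mem_insert.1 hi with rfl | hi
          · rw [key, div_self hjx.ne']; simp
          · rw [key]; exact hz i hi
      refine ⟨Function.update l j ((g x - ∑ i ∈ s, l i * f i x) / f j x), fun i => ?_, ?_⟩
      · rcases eq_or_ne i j with rfl | hi
        · rw [Function.update_self]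
          refine div_nonneg (sub_nonneg.2 (le_trans ?_ hgx.le)) hjx.le
          exact Finset.sum_nonpos fun i hi => mul_nonpos_of_nonneg_of_nonpos (hl i) (hx i hi)
        · simpa [hi] using hl i
      · rw [Finset.sum_insert hj, Function.update_self]
        have h1 : ∑ i ∈ s, Function.update l j ((g x - ∑ i ∈ s, l i * f i x) / f j x) i • f i =
            ∑ i ∈ s, l i • f i := Finset.sum_congr rfl fun i hi => by
          rw [Function.update_of_ne (ne_of_mem_of_not_mem hi hj)]
        rw [h1]
        refine LinearMap.ext fun z => ?_
        have h2 := LinearMap.congr_fun hg z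
        simp only [LinearMap.sub_apply, LinearMap.smul_apply, smul_eq_mul, LinearMap.coe_sum,
          Finset.sum_apply, LinearMap.add_apply] at h2 ⊢
        have h3 : ∑ i ∈ s, l i * (f i z - f i x / f j x * f j z) =
            ∑ i ∈ s, l i * f i z - (∑ i ∈ s, l i * f i x) / f j x * f j z := by
          rw [Finset.sum_div, Finset.sum_mul, ← Finset.sum_sub_distrib]
          exact Finset.sum_congr rfl fun i _ => by ring
        rw [h3] at h2
        rw [sub_div, sub_mul]
        linarith

theorem exists_common_denominator {ε : Type*} (E : Finset ε) (z : ε → ℚ)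
    (hz : ∀ e ∈ E, 0 < z e) :
    ∃ D : ℕ, ∀ e, ∃ k : ℕ, e ∈ E → 0 < k ∧ (k : ℚ) = D * z e := by
  refine ⟨∏ e ∈ E, (z e).den, fun e => ?_⟩
  by_cases he : e ∈ E
  · obtain ⟨q, hq⟩ := Finset.dvd_prod_of_mem (fun e => (z e).den) he
    have h1 : 0 < (z e).num := Rat.num_pos.2 (hz e he)
    have h2 : 0 < ∏ e ∈ E, (z e).den := Finset.prod_pos fun e _ => (z e).den_pos
    refine ⟨q * (z e).num.toNat, fun _ => ⟨?_, ?_⟩⟩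
    · refine Nat.mul_pos (Nat.pos_of_ne_zero ?_) (by omega)
      rintro rfl
      rw [hq] at h2
      simp at h2
    · rw [hq]
      have h3 : (((z e).num.toNat : ℕ) : ℚ) = (z e).num := by
        exact_mod_cast Int.toNat_of_nonneg h1.le
      push_cast
      rw [h3]
      have h4 := Rat.den_mul_eq_num (z e)
      rw [← h4]
      ring
  · exact ⟨0, fun h => absurd h he⟩

/-- Either there is a circulation on the edge set `E` that uses every edge and has non-negative
weight, or some non-negative combination of the weights, corrected by a potential, decreases
along some edge and increases along none. -/
theorem exists_circulation_or_potential {ε N : Type*} [DecidableEq ε] {n : ℕ} (src tgt : ε → N)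
    (E : Finset ε) (φ : ε → Fin n → ℤ) :
    (∃ X : Multiset ε, (∀ e, e ∈ X ↔ e ∈ E) ∧ X.map src = X.map tgt ∧
      ∀ i, 0 ≤ (X.map fun e => φ e i).sum) ∨
    ∃ (y : Fin n → ℚ) (π : N → ℚ), (∀ i, 0 ≤ y i) ∧
      (∀ e ∈ E, ∑ i, y i * φ e i + π (tgt e) - π (src e) ≤ 0) ∧
      ∃ e ∈ E, ∑ i, y i * φ e i + π (tgt e) - π (src e) < 0 := by
  classical
  let F : ε → ((Fin n → ℚ) × (N → ℚ)) →ₗ[ℚ] ℚ := fun e =>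
    { toFun := fun x => ∑ i, x.1 i * φ e i + x.2 (tgt e) - x.2 (src e)
      map_add' := fun x x' => by
        simp only [Prod.fst_add, Prod.snd_add, Pi.add_apply, add_mul, Finset.sum_add_distrib]
        ring
      map_smul' := fun r x => by
        simp only [Prod.smul_fst, Prod.smul_snd, Pi.smul_apply, smul_eq_mul, RingHom.id_apply,
          mul_assoc, ← Finset.mul_sum]
        ring }
  let H : Fin n → ((Fin n → ℚ) × (N → ℚ)) →ₗ[ℚ] ℚ := fun i =>
    -((LinearMap.proj i).comp (LinearMap.fst ℚ _ _))
  have hF : ∀ e x, F e x = ∑ i, x.1 i * φ e i + x.2 (tgt e) - x.2 (src e) := fun e x => rfl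
  have hH : ∀ i x, H i x = -x.1 i := fun i x => rfl
  -- A point `x = (y, π)` is a candidate potential. The functional `-∑ F e` is positive at an
  -- admissible point exactly when some edge decreases strictly; if this never happens, Farkas'
  -- lemma applies.
  by_cases h : ∀ x, (∀ i ∈ E.disjSum Finset.univ, (Sum.elim F H) i x ≤ 0) →
      (-∑ e ∈ E, F e) x ≤ 0
  · left
    obtain ⟨l, hl, hg⟩ := exists_nonneg_combination_of_implies _ _ _ h
    -- The extra `1` makes every edge multiplicity positive. Evaluation at the indicator potential
    -- of a node gives flow conservation there; evaluation at a unit vector in `y` gives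
    -- non-negative balance.
    have hg' : ∀ x, ∑ e ∈ E, (1 + l (Sum.inl e)) * F e x =
        ∑ i, l (Sum.inr i) * x.1 i := by
      intro x
      have h1 := LinearMap.congr_fun hg x
      rw [Finset.sum_disjSum] at h1
      simp only [LinearMap.neg_apply, LinearMap.coe_sum, Finset.sum_apply, LinearMap.add_apply,
        LinearMap.smul_apply, smul_eq_mul, Sum.elim_inl, Sum.elim_inr, hH, mul_neg,
        Finset.sum_neg_distrib] at h1
      simp only [add_mul, one_mul, Finset.sum_add_distrib]
      linarith
    have hz : ∀ e ∈ E, 0 < 1 + l (Sum.inl e) := fun e _ => by have := hl (Sum.inl e); linarith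
    obtain ⟨D, hk⟩ := exists_common_denominator E _ hz
    choose k hk using hk
    have hsum : ∀ (A : Type) [AddCommMonoid A] (w : ε → A),
        ((∑ e ∈ E, k e • ({e} : Multiset ε)).map w).sum = ∑ e ∈ E, k e • w e := by
      intro A _ w
      rw [← Multiset.coe_mapAddMonoidHom, ← Multiset.coe_sumAddMonoidHom, map_sum, map_sum]
      refine Finset.sum_congr rfl fun e _ => ?_
      rw [map_nsmul, map_nsmul]
      simp
    refine ⟨∑ e ∈ E, k e • {e}, fun e => ?_, ?_, fun i => ?_⟩
    · rw [Multiset.mem_sum]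
      constructor
      · rintro ⟨e', he', h1⟩
        rw [Multiset.mem_singleton.1 (Multiset.mem_of_mem_nsmul h1)]
        exact he'
      · intro he
        exact ⟨e, he, Multiset.mem_nsmul.2 ⟨(hk e he).1.ne', Multiset.mem_singleton_self e⟩⟩
    · refine Multiset.ext.2 fun v => ?_
      have hc : ∀ w : ε → N, Multiset.count v ((∑ e ∈ E, k e • ({e} : Multiset ε)).map w) =
          ∑ e ∈ E, k e * if w e = v then 1 else 0 := by
        intro w
        rw [← Multiset.coe_mapAddMonoidHom, map_sum, Multiset.count_sum']
        refine Finset.sum_congr rfl fun e _ => ?_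
        rw [map_nsmul, Multiset.count_nsmul]
        simp [Multiset.count_singleton, eq_comm]
      rw [hc, hc]
      have h1 := hg' (0, Pi.single v 1)
      simp only [hF, Pi.zero_apply, zero_mul, mul_zero, Finset.sum_const_zero, zero_add] at h1
      have h2 : (∑ e ∈ E, (k e : ℚ) * if src e = v then 1 else 0) =
          ∑ e ∈ E, (k e : ℚ) * if tgt e = v then 1 else 0 := by
        have h3 := congrArg (fun r => -(D : ℚ) * r) h1
        simp only [mul_zero, Finset.mul_sum] at h3
        rw [← sub_eq_zero, ← Finset.sum_sub_distrib]
        refine Eq.trans ?_ h3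
        refine Finset.sum_congr rfl fun e he => ?_
        rw [(hk e he).2, Pi.single_apply, Pi.single_apply]
        ring
      exact_mod_cast h2
    · rw [hsum ℤ (fun e => φ e i)]
      have h1 := hg' (Pi.single i 1, 0)
      simp only [hF, Pi.zero_apply, add_zero, sub_zero, Pi.single_apply, ite_mul, one_mul,
        zero_mul, Finset.sum_ite_eq', Finset.mem_univ, if_true, mul_ite, mul_one, mul_zero] at h1
      have h2 : ((∑ e ∈ E, k e • φ e i : ℤ) : ℚ) = D * l (Sum.inr i) := by
        rw [← h1, Finset.mul_sum]
        simp only [nsmul_eq_mul]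
        push_cast
        refine Finset.sum_congr rfl fun e he => ?_
        rw [(hk e he).2]
        ring
      have h3 : (0 : ℚ) ≤ D * l (Sum.inr i) := mul_nonneg (by positivity) (hl _)
      rw [← h2] at h3
      exact_mod_cast h3
  · right
    push Not at h
    obtain ⟨x, hx, hgx⟩ := h
    have hxE : ∀ e ∈ E, F e x ≤ 0 := fun e he => hx (Sum.inl e) (by simpa using he)
    refine ⟨x.1, x.2, fun i => ?_, hxE, ?_⟩
    · have := hx (Sum.inr i) (by simp)
      simp only [Sum.elim_inr, hH] at this
      linarith
    · by_contra hno
      push Not at hno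
      have h1 : 0 ≤ ∑ e ∈ E, F e x := Finset.sum_nonneg hno
      simp only [LinearMap.neg_apply, LinearMap.coe_sum, Finset.sum_apply] at hgx
      linarith

end Farkas

/-! ### Realizing circulations by cycles -/

section Circulations

variable {Q : Type*} {d : ℕ} {α : Type*}

theorem IsKMPath.map_src_add {G : Set (KMEdge Q d α)} {c c' : ExtConfig Q d}
    {p : List (KMEdge Q d α)} (h : IsKMPath G c p c') :
    (p : Multiset (KMEdge Q d α)).map KMEdge.src + {c'} =
      (p : Multiset (KMEdge Q d α)).map KMEdge.tgt + {c} := by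
  induction p generalizing c with
  | nil => obtain rfl : c = c' := h; rfl
  | cons e p ih =>
    obtain ⟨-, rfl, h3⟩ := h
    rw [← Multiset.cons_coe, Multiset.map_cons, Multiset.map_cons, Multiset.cons_add, ih h3,
      ← Multiset.singleton_add, ← Multiset.singleton_add e.tgt]
    abel

/-- Walk from `u` along unused edges. As long as the current node is not `v`, the balance condition
provides an outgoing edge; on arrival at `v` the remaining edges are balanced. -/
theorem exists_path_of_flow {G : Set (KMEdge Q d α)} (X : Multiset (KMEdge Q d α))
    (hXG : ∀ e ∈ X, e ∈ G) (u v : ExtConfig Q d)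
    (hX : X.map KMEdge.src + {v} = X.map KMEdge.tgt + {u}) :
    ∃ (p : List (KMEdge Q d α)) (Y : Multiset (KMEdge Q d α)), X = p + Y ∧ IsKMPath G u p v ∧
      Y.map KMEdge.src = Y.map KMEdge.tgt := by
  induction hn : Multiset.card X generalizing X u with
  | zero =>
    obtain rfl := Multiset.card_eq_zero.1 hn
    obtain rfl : v = u := by simpa using hX
    exact ⟨[], 0, rfl, rfl, rfl⟩
  | succ n ih =>
    by_cases huv : u = v
    · subst huv
      exact ⟨[], X, by simp, rfl, add_right_cancel hX⟩
    · have hu : u ∈ X.map KMEdge.src + {v} := by rw [hX]; simp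
      have hu' : u ∈ X.map KMEdge.src := by
        rcases Multiset.mem_add.1 hu with h | h
        · exact h
        · exact absurd (Multiset.mem_singleton.1 h) huv
      obtain ⟨e, he, rfl⟩ := Multiset.mem_map.1 hu'
      obtain ⟨X, rfl⟩ := Multiset.exists_cons_of_mem he
      have hX' : X.map KMEdge.src + {v} = X.map KMEdge.tgt + {e.tgt} := by
        rw [Multiset.map_cons, Multiset.map_cons, ← Multiset.singleton_add,
          ← Multiset.singleton_add e.tgt] at hX
        refine add_left_cancel (a := {e.src}) ?_
        rw [← add_assoc, hX]
        abel
      obtain ⟨p, Y, rfl, hp, hY⟩ := ih X (fun e he => hXG e (Multiset.mem_cons_of_mem he)) e.tgt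
        hX' (by simpa using hn)
      exact ⟨e :: p, Y, by rw [← Multiset.cons_coe, Multiset.cons_add], ⟨hXG e (Multiset.mem_cons_self _ _), rfl, hp⟩, hY⟩

/-- Hierholzer's argument: an edge `e` of `X` is completed within `X` to a closed walk, which is
spliced into `a` just before an occurrence of `e`. As every edge of `X` lies on `a`, connectedness
is automatic. -/
theorem exists_cycle_add {G : Set (KMEdge Q d α)} {c : ExtConfig Q d}
    (a : List (KMEdge Q d α)) (ha : IsKMPath G c a c) (X : Multiset (KMEdge Q d α))
    (hXa : ∀ e ∈ X, e ∈ a) (hX : X.map KMEdge.src = X.map KMEdge.tgt) :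
    ∃ b : List (KMEdge Q d α), IsKMPath G c b c ∧ (b : Multiset (KMEdge Q d α)) = a + X := by
  induction hn : Multiset.card X using Nat.strong_induction_on generalizing X a with
  | _ n ih =>
    rcases Multiset.empty_or_exists_mem X with rfl | ⟨e, he⟩
    · exact ⟨a, ha, by simp⟩
    · have hea := hXa e he
      obtain ⟨X, rfl⟩ := Multiset.exists_cons_of_mem he
      have hflow : X.map KMEdge.src + {e.src} = X.map KMEdge.tgt + {e.tgt} := by
        rw [Multiset.map_cons, Multiset.map_cons, ← Multiset.singleton_add,
          ← Multiset.singleton_add e.tgt] at hX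
        rw [add_comm, hX, add_comm]
      obtain ⟨p, Y, rfl, hp, hY⟩ := exists_path_of_flow (G := G) X
        (fun f hf => ha.mem f (hXa f (Multiset.mem_cons_of_mem hf))) _ _ hflow
      obtain ⟨s, t, rfl⟩ := List.append_of_mem hea
      obtain ⟨b, hs, heG, rfl, ht⟩ := isKMPath_append.1 ha
      have hcard : Multiset.card Y < n := by
        rw [← hn, Multiset.card_cons, Multiset.card_add]; omega
      obtain ⟨b, hb, hb'⟩ := ih (Multiset.card Y) hcard
        (s ++ (e :: p) ++ e :: t)
        (isKMPath_append.2 ⟨_, isKMPath_append.2 ⟨_, hs, heG, rfl, hp⟩, heG, rfl, ht⟩) Y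
        (fun f hf => by
          have h1 := hXa f (Multiset.mem_cons_of_mem (Multiset.mem_add.2 (Or.inr hf)))
          rw [List.mem_append, List.mem_append]
          rcases List.mem_append.1 h1 with h2 | h2
          · exact Or.inl (Or.inl h2)
          · exact Or.inr h2) hY rfl
      refine ⟨b, hb, ?_⟩
      rw [hb']
      simp only [← Multiset.coe_add, ← Multiset.cons_coe, ← Multiset.singleton_add]
      abel

/-! ### Effects and balances as sums over edge multisets; flowers from circulations -/

theorem counterEffect_eq_sum (p : List (KMEdge Q d α)) :
    counterEffect p =
      ((p : Multiset (KMEdge Q d α)).map fun e => e.label.effect).sum := by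
  simp [counterEffect]

theorem letterBalance_nil {n : ℕ} : letterBalance ([] : List (DyckLetter n)) = 0 := by
  funext i; simp [letterBalance]

theorem letterBalance_append {n : ℕ} (u v : List (DyckLetter n)) :
    letterBalance (u ++ v) = letterBalance u + letterBalance v := by
  funext i
  simp only [letterBalance, List.count_append, Pi.add_apply]
  push_cast
  ring

theorem pathBalance_cons {n : ℕ} (e : KMEdge Q d (DyckLetter n))
    (q : List (KMEdge Q d (DyckLetter n))) :
    pathBalance (e :: q) = letterBalance e.label.label + pathBalance q := by
  rw [pathBalance, List.flatMap_cons, letterBalance_append]; rfl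

theorem pathBalance_eq_sum {n : ℕ} (p : List (KMEdge Q d (DyckLetter n))) :
    pathBalance p = ((p : Multiset (KMEdge Q d (DyckLetter n))).map
      fun e => letterBalance e.label.label).sum := by
  induction p with
  | nil => simp [pathBalance, letterBalance_nil]
  | cons e p ih =>
    rw [pathBalance_cons, ih]
    simp

/-- Choose `b` with `a + b = M • X` as edge multisets, which makes the balance of the first two
cycles non-negative, and then `g` with `b + g = N • a`, which makes all remaining quantities
multiples of those of `a`. -/
theorem exists_flower_of_circulation {n : ℕ} {V : BuchiVASS Q d (DyckLetter n)}
    {G : Set (KMEdge Q d (DyckLetter n))} {c : ExtConfig Q d} (hc : c.1 ∈ V.final)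
    {a : List (KMEdge Q d (DyckLetter n))} (ha : IsKMCycle G c a) (hδ : 0 ≤ counterEffect a)
    (X : Multiset (KMEdge Q d (DyckLetter n))) (hXa : ∀ e, e ∈ X ↔ e ∈ a)
    (hX : X.map KMEdge.src = X.map KMEdge.tgt)
    (hφ : ∀ i, 0 ≤ (X.map fun e => letterBalance e.label.label i).sum) :
    ∃ b g, IsInseparabilityFlower V G c a b g ∧ 0 ≤ counterEffect a ∧
      ∃ N : ℕ, 0 < N ∧ counterEffect b + counterEffect g = N • counterEffect a ∧
        pathBalance b + pathBalance g = N • pathBalance a := by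
  classical
  obtain ⟨hne, hap⟩ := ha
  have hbal : (a : Multiset (KMEdge Q d (DyckLetter n))).map KMEdge.src = (a : Multiset (KMEdge Q d (DyckLetter n))).map KMEdge.tgt :=
    add_right_cancel hap.map_src_add
  have hbal_sub : ∀ Y Z : Multiset (KMEdge Q d (DyckLetter n)), Z ≤ Y →
      Y.map KMEdge.src = Y.map KMEdge.tgt → Z.map KMEdge.src = Z.map KMEdge.tgt →
      (Y - Z).map KMEdge.src = (Y - Z).map KMEdge.tgt := by
    intro Y Z hle hY hZ
    refine add_right_cancel (b := Z.map KMEdge.src) ?_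
    rw [← Multiset.map_add, tsub_add_cancel_of_le hle, hZ, ← Multiset.map_add,
      tsub_add_cancel_of_le hle, hY]
  -- Large enough for `M • X` to contain `a` twice: once for `a` itself and once as the skeleton of
  -- `b`.
  obtain ⟨M, hM⟩ : ∃ M, M = 2 * a.length := ⟨_, rfl⟩
  have hle1 : (2 • a : Multiset (KMEdge Q d (DyckLetter n))) ≤ M • X := by
    refine Multiset.le_iff_count.2 fun e => ?_
    rw [Multiset.count_nsmul, Multiset.count_nsmul]
    by_cases he : e ∈ a
    · have h1 : 0 < X.count e := Multiset.count_pos.2 ((hXa e).2 he)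
      have h2 : a.count e ≤ a.length := List.count_le_length
      rw [Multiset.coe_count, hM]
      nlinarith
    · rw [Multiset.coe_count, List.count_eq_zero_of_not_mem he]; simp
  obtain ⟨b, hb, hb'⟩ := exists_cycle_add a hap (M • X - 2 • (a : Multiset (KMEdge Q d (DyckLetter n))))
    (fun e he => (hXa e).1 (Multiset.mem_of_mem_nsmul (Multiset.mem_of_le tsub_le_self he)))
    (hbal_sub _ _ hle1 (by rw [Multiset.map_nsmul, Multiset.map_nsmul, hX])
      (by rw [Multiset.map_nsmul, Multiset.map_nsmul, hbal]))
  have hab : (a + b : Multiset (KMEdge Q d (DyckLetter n))) = M • X := by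
    rw [hb', ← add_assoc, ← two_nsmul, add_tsub_cancel_of_le hle1]
  have hba : ∀ e ∈ b, e ∈ a := by
    intro e he
    have h1 : e ∈ (a + b : Multiset (KMEdge Q d (DyckLetter n))) :=
      Multiset.mem_add.2 (Or.inr he)
    rw [hab] at h1
    exact (hXa e).1 (Multiset.mem_of_mem_nsmul h1)
  -- One copy of `a` is the skeleton of `g`; the other `b.length` copies contain `b`.
  obtain ⟨N, hN⟩ : ∃ N, N = 1 + b.length := ⟨_, rfl⟩
  have hle2 : (b + a : Multiset (KMEdge Q d (DyckLetter n))) ≤ N • (a : Multiset (KMEdge Q d (DyckLetter n))) := by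
    refine Multiset.le_iff_count.2 fun e => ?_
    rw [Multiset.count_nsmul, Multiset.count_add, Multiset.coe_count, Multiset.coe_count, hN,
      add_mul, one_mul, add_comm]
    refine Nat.add_le_add_left ?_ _
    by_cases he : e ∈ b
    · have h1 : 0 < a.count e := List.count_pos_iff.2 (hba e he)
      have h2 : b.count e ≤ b.length := List.count_le_length
      nlinarith
    · rw [List.count_eq_zero_of_not_mem he]; simp
  have hbbal : (b : Multiset (KMEdge Q d (DyckLetter n))).map KMEdge.src = (b : Multiset (KMEdge Q d (DyckLetter n))).map KMEdge.tgt :=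
    add_right_cancel hb.map_src_add
  obtain ⟨g, hg, hg'⟩ := exists_cycle_add a hap (N • (a : Multiset (KMEdge Q d (DyckLetter n))) - (b + a))
    (fun e he => Multiset.mem_of_mem_nsmul (Multiset.mem_of_le tsub_le_self he))
    (hbal_sub _ _ hle2 (by rw [Multiset.map_nsmul, Multiset.map_nsmul, hbal])
      (by rw [Multiset.map_add, Multiset.map_add, hbal, hbbal]))
  have hbg : (b + g : Multiset (KMEdge Q d (DyckLetter n))) = N • (a : Multiset (KMEdge Q d (DyckLetter n))) := by
    rw [hg', ← add_assoc, add_tsub_cancel_of_le hle2]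
  have hbne : b ≠ [] := by
    rintro rfl
    have := congrArg Multiset.card hb'
    rw [Multiset.card_add] at this
    simp only [Multiset.coe_card, List.length_nil] at this
    exact hne (List.length_eq_zero_iff.1 (by omega))
  have hgne : g ≠ [] := by
    rintro rfl
    have := congrArg Multiset.card hg'
    rw [Multiset.card_add] at this
    simp only [Multiset.coe_card, List.length_nil] at this
    exact hne (List.length_eq_zero_iff.1 (by omega))
  have hδN : counterEffect b + counterEffect g = N • counterEffect a := by
    rw [counterEffect_eq_sum, counterEffect_eq_sum, counterEffect_eq_sum, ← Multiset.sum_add,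
      ← Multiset.map_add, hbg, Multiset.map_nsmul, Multiset.sum_nsmul]
  have hφN : pathBalance b + pathBalance g = N • pathBalance a := by
    rw [pathBalance_eq_sum, pathBalance_eq_sum, pathBalance_eq_sum, ← Multiset.sum_add,
      ← Multiset.map_add, hbg, Multiset.map_nsmul, Multiset.sum_nsmul]
  refine ⟨b, g, ⟨hc, ⟨hne, hap⟩, ⟨hbne, hb⟩, ⟨hgne, hg⟩, ?_, ?_, ⟨1 + N, fun i => ?_⟩⟩, hδ, N,
    by omega, hδN, hφN⟩
  · rw [add_assoc, hδN]
    exact add_nonneg hδ (nsmul_nonneg hδ N)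
  · rw [pathBalance_eq_sum, pathBalance_eq_sum, ← Multiset.sum_add, ← Multiset.map_add, hab,
      Multiset.map_nsmul, Multiset.sum_nsmul]
    refine nsmul_nonneg (fun i => ?_) M
    have h1 := hφ i
    have h2 : ∀ Y : Multiset (KMEdge Q d (DyckLetter n)),
        (Y.map fun e => letterBalance e.label.label).sum i =
          (Y.map fun e => letterBalance e.label.label i).sum := by
      intro Y
      induction Y using Multiset.induction_on with
      | empty => simp
      | cons e Y ih => simp [ih]
    rw [h2]
    exact h1
  · have := congrFun hφN i
    simp only [Pi.add_apply, Pi.smul_apply] at this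
    rw [add_assoc, this, nsmul_eq_mul]
    push_cast
    ring

end Circulations

/-! ### Flowers prevent regular separability -/

section FlowerInseparable

variable {Q : Type*} {d : ℕ} {α : Type*}

/-- The `k`-fold repetition of a finite word. -/
def wordPow (u : List α) (k : ℕ) : List α := (List.replicate k u).flatten

theorem wordPow_zero (u : List α) : wordPow u 0 = [] := rfl

theorem wordPow_succ (u : List α) (k : ℕ) : wordPow u (k + 1) = wordPow u k ++ u := by
  simp [wordPow, List.replicate_succ']

theorem wordPow_add (u : List α) (j k : ℕ) : wordPow u (j + k) = wordPow u j ++ wordPow u k := by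
  rw [wordPow, List.replicate_add, List.flatten_append, ← wordPow, ← wordPow]

theorem length_wordPow (u : List α) (k : ℕ) : (wordPow u k).length = k * u.length := by
  simp [wordPow]

theorem concatPrefix_const (u : List α) (k : ℕ) : concatPrefix (fun _ => u) k = wordPow u k := by
  induction k with
  | zero => rfl
  | succ k ih => rw [concatPrefix_succ, wordPow_succ, ih]

theorem flatMap_replicate_flatten {β : Type*} (f : α → List β) (p : List α) (k : ℕ) :
    ((List.replicate k p).flatten).flatMap f = wordPow (p.flatMap f) k := by
  induction k with
  | zero => rfl
  | succ k ih =>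
    rw [List.replicate_succ', List.flatten_append, List.flatMap_append, ih, wordPow_succ]
    simp

theorem prefix_append_cases {u v q : List α} (h : q <+: u ++ v) :
    q <+: u ∨ ∃ r, r <+: v ∧ q = u ++ r := by
  obtain ⟨t, ht⟩ := h
  rcases List.append_eq_append_iff.1 ht with ⟨a, h1, -⟩ | ⟨a, h1, h2⟩
  · exact Or.inl ⟨a, h1.symm⟩
  · exact Or.inr ⟨a, ⟨t, h2.symm⟩, h1⟩

theorem prefix_wordPow {u q : List α} {k : ℕ} (h : q <+: wordPow u k) :
    q = [] ∨ ∃ j r, j < k ∧ r <+: u ∧ q = wordPow u j ++ r := by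
  induction k with
  | zero => exact Or.inl (List.prefix_nil.1 h)
  | succ k ih =>
    rw [wordPow_succ] at h
    rcases prefix_append_cases h with h1 | ⟨r, h1, h2⟩
    · rcases ih h1 with h3 | ⟨j, r, h3, h4, h5⟩
      · exact Or.inl h3
      · exact Or.inr ⟨j, r, by omega, h4, h5⟩
    · exact Or.inr ⟨k, r, by omega, h1, h2⟩

theorem letterBalance_wordPow {n : ℕ} (u : List (DyckLetter n)) (k : ℕ) (i : Fin n) :
    letterBalance (wordPow u k) i = k * letterBalance u i := by
  induction k with
  | zero => simp [wordPow_zero, letterBalance_nil]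
  | succ k ih =>
    rw [wordPow_succ, letterBalance_append, Pi.add_apply, ih]
    push_cast
    ring

theorem neg_length_le_letterBalance {n : ℕ} (u : List (DyckLetter n)) (i : Fin n) :
    -(u.length : ℤ) ≤ letterBalance u i := by
  have : u.count (i, false) ≤ u.length := List.count_le_length
  simp only [letterBalance]
  omega

/-- `K` is a common multiple of the three periods that exceeds the three preperiods, so `xK` and `K`
differ by a multiple of each period. -/
theorem exists_uniform_exponent {M : Type*} [Finite M] (h : List α → M)
    (hh : ∀ u u' v v', h u = h u' → h v = h v' → h (u ++ v) = h (u' ++ v'))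
    (u v w : List α) :
    ∃ K, 0 < K ∧ ∀ x, 0 < x → h (wordPow u (x * K)) = h (wordPow u K) ∧
      h (wordPow v (x * K)) = h (wordPow v K) ∧ h (wordPow w (x * K)) = h (wordPow w K) := by
  obtain ⟨i₁, p₁, h₁, H₁⟩ := exists_pow_congruent h hh u
  obtain ⟨i₂, p₂, h₂, H₂⟩ := exists_pow_congruent h hh v
  obtain ⟨i₃, p₃, h₃, H₃⟩ := exists_pow_congruent h hh w
  obtain ⟨m, hm⟩ : ∃ m, m = i₁ + i₂ + i₃ + 1 := ⟨_, rfl⟩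
  have hle : m ≤ m * (p₁ * p₂ * p₃) := Nat.le_mul_of_pos_right _ (by positivity)
  refine ⟨m * (p₁ * p₂ * p₃), by omega, fun x hx => ?_⟩
  obtain ⟨x, rfl⟩ : ∃ x', x = x' + 1 := ⟨x - 1, by omega⟩
  have h4 := H₁ (m * (p₁ * p₂ * p₃)) (x * m * p₂ * p₃) (by omega)
  have h5 := H₂ (m * (p₁ * p₂ * p₃)) (x * m * p₁ * p₃) (by omega)
  have h6 := H₃ (m * (p₁ * p₂ * p₃)) (x * m * p₁ * p₂) (by omega)
  have e4 : (x + 1) * (m * (p₁ * p₂ * p₃)) = m * (p₁ * p₂ * p₃) + x * m * p₂ * p₃ * p₁ := by ring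
  have e5 : (x + 1) * (m * (p₁ * p₂ * p₃)) = m * (p₁ * p₂ * p₃) + x * m * p₁ * p₃ * p₂ := by ring
  have e6 : (x + 1) * (m * (p₁ * p₂ * p₃)) = m * (p₁ * p₂ * p₃) + x * m * p₁ * p₂ * p₃ := by ring
  exact ⟨by rw [wordPow, e4, h4, wordPow], by rw [wordPow, e5, h5, wordPow],
    by rw [wordPow, e6, h6, wordPow]⟩

/-- Write `r = p / q` in lowest terms. For `r ≠ 0`, take `x = |p| - p + q`, `y = |p| + q`, `z = q`:
since `q(a + b + c) = p a`, the weighted sum collapses to `|p| (a + b)`. For `r = 0` the sum already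
vanishes. The final alternative serves to compare prefixes in coordinates where the total balance is
zero. -/
theorem exists_repetition_numbers {ι : Type*} (a b c : ι → ℤ)
    (h : ∃ r : ℚ, ∀ i, ((a i + b i + c i : ℤ) : ℚ) = r * (a i : ℚ)) :
    ∃ x y z s : ℕ, 0 < x ∧ 0 < y ∧ 0 < z ∧
      (∀ i, (x : ℤ) * a i + y * b i + z * c i = s * (a i + b i)) ∧
      ((x = 1 ∧ y = 1 ∧ z = 1) ∨ (z ≤ y ∧ ∀ i, a i + b i + c i = 0 → a i = 0)) := by
  obtain ⟨r, hr⟩ := h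
  by_cases h0 : r = 0
  · refine ⟨1, 1, 1, 0, one_pos, one_pos, one_pos, fun i => ?_, Or.inl ⟨rfl, rfl, rfl⟩⟩
    have := hr i
    rw [h0, zero_mul] at this
    have h1 : a i + b i + c i = 0 := by exact_mod_cast this
    push_cast
    linarith
  · have hden := r.den_pos
    have hx : 0 < (r.num.natAbs : ℤ) - r.num + r.den := by omega
    refine ⟨((r.num.natAbs : ℤ) - r.num + r.den).toNat, r.num.natAbs + r.den, r.den,
      r.num.natAbs, by omega, by omega, hden, fun i => ?_, Or.inr ⟨by omega, fun i hi => ?_⟩⟩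
    · have h1 : (r.den : ℤ) * (a i + b i + c i) = r.num * a i := by
        have h2 : (r.den : ℚ) * ((a i + b i + c i : ℤ) : ℚ) = r.num * a i := by
          rw [hr i, ← Rat.den_mul_eq_num r]; ring
        exact_mod_cast h2
      rw [Int.toNat_of_nonneg hx.le]
      push_cast
      linear_combination h1
    · have h1 := hr i
      rw [hi, Int.cast_zero] at h1
      rcases mul_eq_zero.1 h1.symm with h2 | h2
      · exact absurd h2 h0
      · exact_mod_cast h2

/-- Increasing the numbers of repetitions does not create smaller balances of prefixes when the
first factor is neutral and the other two compensate each other. -/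
theorem exists_prefix_letterBalance_le {n : ℕ} {u v w : List (DyckLetter n)} {i : Fin n} {K : ℕ}
    (hK : 0 < K) {x y z : ℕ} (hzy : z ≤ y) (hu : letterBalance u i = 0)
    (hv : 0 ≤ letterBalance v i) (hw : letterBalance w i = -letterBalance v i)
    {q : List (DyckLetter n)}
    (hq : q <+: wordPow u (x * K) ++ wordPow v (y * K) ++ wordPow w (z * K)) :
    ∃ q₀, q₀ <+: wordPow u K ++ wordPow v K ++ wordPow w K ∧
      letterBalance q₀ i ≤ letterBalance q i := by
  obtain ⟨k, rfl⟩ : ∃ k, K = k + 1 := ⟨K - 1, by omega⟩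
  have hpre : ∀ {t r : List (DyckLetter n)}, r <+: t → r <+: wordPow t (k + 1) := by
    intro t r hr
    rw [Nat.add_comm, wordPow_add]
    exact (hr.trans (by simp [wordPow])).trans (List.prefix_append _ _)
  rcases prefix_append_cases hq with hq | ⟨q₁, hq₁, rfl⟩
  · rcases prefix_append_cases hq with hq | ⟨q₁, hq₁, rfl⟩
    · rcases prefix_wordPow hq with rfl | ⟨j, r, hj, hr, rfl⟩
      · exact ⟨[], List.nil_prefix, le_rfl⟩
      · refine ⟨r, ((hpre hr).trans (List.prefix_append _ _)).trans (List.prefix_append _ _), ?_⟩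
        rw [letterBalance_append, Pi.add_apply, letterBalance_wordPow, hu]
        simp
    · rcases prefix_wordPow hq₁ with rfl | ⟨j, r, hj, hr, rfl⟩
      · refine ⟨[], List.nil_prefix, ?_⟩
        rw [letterBalance_append, Pi.add_apply, letterBalance_wordPow, hu]
        simp
      · refine ⟨wordPow u (k + 1) ++ r,
          ((List.prefix_append_right_inj _).2 (hpre hr)).trans (List.prefix_append _ _), ?_⟩
        simp only [letterBalance_append, Pi.add_apply, letterBalance_wordPow, hu]
        have : (0 : ℤ) ≤ j * letterBalance v i := by positivity
        linarith
  · rcases prefix_wordPow hq₁ with rfl | ⟨j, r, hj, hr, rfl⟩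
    · refine ⟨[], List.nil_prefix, ?_⟩
      simp only [letterBalance_append, Pi.add_apply, letterBalance_wordPow, hu, letterBalance_nil,
        Pi.zero_apply]
      have : (0 : ℤ) ≤ ((y * (k + 1) : ℕ) : ℤ) * letterBalance v i := by positivity
      linarith
    -- After `k = K - 1` copies of `w` the short word has exactly one balance of `v` left; since `j
    -- < yK`, the long word has at least that much.
    · refine ⟨wordPow u (k + 1) ++ wordPow v (k + 1) ++ (wordPow w k ++ r),
        (List.prefix_append_right_inj _).2 ?_, ?_⟩
      · rw [wordPow_succ w]
        exact (List.prefix_append_right_inj _).2 hr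
      · simp only [letterBalance_append, Pi.add_apply, letterBalance_wordPow, hu, hw]
        have h1 : j < y * (k + 1) := hj.trans_le (Nat.mul_le_mul_right _ hzy)
        have h2 : (1 : ℤ) * letterBalance v i ≤
            (((y * (k + 1) : ℕ) : ℤ) - j) * letterBalance v i :=
          mul_le_mul_of_nonneg_right (by omega) hv
        push_cast at h2 ⊢
        linarith

/-- A sufficient condition for a word of the form `u B B B …` to be in the Dyck language. -/
theorem mem_dyckLanguage_of_periodic {n : ℕ} {u B : List (DyckLetter n)}
    {w : Stream' (DyckLetter n)}
    (hw : IsConcatenation (fun j => Nat.casesOn j u fun _ => B) w)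
    (hu : ∀ q i, q <+: u → 0 ≤ letterBalance q i) (hB : ∀ i, 0 ≤ letterBalance B i)
    (huB : ∀ q i, q <+: B → 0 ≤ letterBalance u i + letterBalance q i) :
    w ∈ dyckLanguage n := by
  intro l i
  obtain ⟨k, hk⟩ := hw.unbounded l
  have h1 := w.take_isPrefix (hk.trans (concatPrefix_length_mono _ (Nat.le_succ k)))
  rw [← hw.prefix_eq, concatPrefix_succ', concatPrefix_const] at h1
  change w.take l <+: u ++ wordPow B k at h1
  rcases prefix_append_cases h1 with h2 | ⟨r, h2, h3⟩
  · exact hu _ i h2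
  · rw [h3, letterBalance_append, Pi.add_apply]
    rcases prefix_wordPow h2 with rfl | ⟨j, r, hj, hr, rfl⟩
    · simpa [letterBalance_nil] using hu u i List.prefix_rfl
    · rw [letterBalance_append, Pi.add_apply, letterBalance_wordPow]
      have h4 := huB r i hr
      have h5 : (0 : ℤ) ≤ j * letterBalance B i := mul_nonneg (by positivity) (hB i)
      linarith

/-- A cycle with non-negative effect at a final node can be repeated forever after a suitable
finite run. -/
theorem exists_language_word_of_cycle {V : BuchiVASS Q d α} (hlabel : V.HasInfiniteLabels)
    {G : Set (KMEdge Q d α)} (hG : KMConstruction V G) {c : ExtConfig Q d}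
    (hc : c.1 ∈ V.final) {p : List (KMEdge Q d α)} (hp : IsKMCycle G c p)
    (hδ : 0 ≤ counterEffect p) :
    ∃ (u : List α) (w : Stream' α), w ∈ V.language ∧
      IsConcatenation (fun j => Nat.casesOn j u fun _ => p.flatMap fun e => e.label.label) w := by
  obtain ⟨hne, hpath⟩ := hp
  have hcr : KMReach G V.extInit c := by
    cases p with
    | nil => exact absurd rfl hne
    | cons e p => exact hpath.2.1 ▸ hG.reach_src e hpath.1
  obtain ⟨σ₀, x₀, hσ₀, hx₀⟩ := hG.coverable hcr (counterDrain p)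
  -- Sufficient for firing `p`, and preserved by it because the effect is non-negative.
  let P : (Fin d → ℕ) → Prop := fun x =>
    (∀ i, c.2 i ≠ ⊤ → c.2 i ≤ x i) ∧ ∀ i, c.2 i = ⊤ → counterDrain p ≤ x i
  have hP₀ : P x₀ := by
    refine ⟨fun i hi => ?_, fun i hi => ?_⟩
    · rcases hx₀ i with h | h
      · exact h.le
      · exact absurd h.1 hi
    · rcases hx₀ i with h | h
      · rw [hi] at h; exact absurd h (ENat.top_ne_natCast _)
      · exact h.2
  have hstep : ∀ x : {x // P x}, ∃ x' : {x // P x},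
      V.Steps (c.1, x.1) (pathTransitions p) (c.1, x'.1) := by
    rintro ⟨x, hx⟩
    obtain ⟨x', h1, h2⟩ := hpath.steps hG.isValidEdge x hx.1 hx.2
    have hle : ∀ i, x i ≤ x' i := fun i => by
      have h3 := h2 i
      have h4 : 0 ≤ counterEffect p i := hδ i
      omega
    exact ⟨⟨x', fun i hi => (hx.1 i hi).trans (by exact_mod_cast hle i),
      fun i hi => (hx.2 i hi).trans (hle i)⟩, h1⟩
  choose next hnext using hstep
  let X : ℕ → {x // P x} := fun j => Nat.rec ⟨x₀, hP₀⟩ (fun _ x => next x) j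
  let C : ℕ → Q × (Fin d → ℕ) := fun j => Nat.casesOn j (V.init, 0) fun j => (c.1, (X j).1)
  let σ : ℕ → List (VASSTransition Q d α) := fun j => Nat.casesOn j σ₀ fun _ => pathTransitions p
  have hσ : ∀ j, V.Steps (C j) (σ j) (C (j + 1)) := by
    intro j
    cases j with
    | zero => exact hσ₀
    | succ j => exact hnext (X j)
  have hlen : 0 < (pathTransitions p).length := by
    simpa using List.length_pos_iff.2 hne
  have hu : ∀ N, ∃ k, N ≤ (concatPrefix σ k).length := by
    intro N
    refine ⟨N + 1, ?_⟩
    rw [concatPrefix_succ', List.length_append]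
    change N ≤ _ + (concatPrefix (fun _ => pathTransitions p) N).length
    rw [concatPrefix_const, length_wordPow]
    have := Nat.le_mul_of_pos_right N hlen
    omega
  obtain ⟨t, cc, hrun, ht, hcc⟩ := BuchiVASS.exists_run_of_steps (V := V) (C := C) rfl hσ hu
  have hacc : V.IsAcceptingRun t cc := by
    refine ⟨hrun, fun N => ?_⟩
    obtain ⟨k, hk⟩ := hu N
    refine ⟨_, hk.trans (concatPrefix_length_mono σ (Nat.le_succ k)), ?_⟩
    rw [hcc]
    exact hc
  obtain ⟨w, hw⟩ := hlabel t cc hacc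
  refine ⟨labelWord σ₀, w, ⟨t, cc, hacc, hw⟩, ?_⟩
  have h1 := (isConcatenation_coarsen ht VASSTransition.label w).1 hw
  convert h1 using 2 with j
  cases j with
  | zero => rfl
  | succ j => exact (List.flatMap_map _ _ _).symm

theorem IsInseparabilityFlower.not_regularlySeparable {n : ℕ} {V : BuchiVASS Q d (DyckLetter n)}
    (hlabel : V.HasInfiniteLabels) (hpump : IsPumpable V.language)
    {G : Set (KMEdge Q d (DyckLetter n))} (hG : KMConstruction V G) {c : ExtConfig Q d}
    {a b g : List (KMEdge Q d (DyckLetter n))} (hf : IsInseparabilityFlower V G c a b g) :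
    ¬ RegularlySeparable V.language (dyckLanguage n) := by
  rintro ⟨R, hR, hVR, hRD⟩
  obtain ⟨M, hM, h, hh, hrepl⟩ := hR.exists_congruence
  obtain ⟨word, hword⟩ : ∃ word : List (KMEdge Q d (DyckLetter n)) → List (DyckLetter n),
    word = fun p => p.flatMap fun e => e.label.label := ⟨_, rfl⟩
  have hbal : ∀ p, letterBalance (word p) = pathBalance p := fun p => by rw [hword]; rfl
  obtain ⟨K, hK, hKh⟩ := exists_uniform_exponent h hh (word a) (word b) (word g)
  obtain ⟨x, y, z, s, hx, hy, hz, hsum, hcase⟩ := exists_repetition_numbers _ _ _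
    hf.balance_multiple
  obtain ⟨B₀, hB₀⟩ : ∃ B₀, B₀ = wordPow (word a) K ++ wordPow (word b) K ++ wordPow (word g) K :=
    ⟨_, rfl⟩
  obtain ⟨B₁, hB₁⟩ : ∃ B₁, B₁ = wordPow (word a) (x * K) ++ wordPow (word b) (y * K) ++
    wordPow (word g) (z * K) := ⟨_, rfl⟩
  have hhB : h B₀ = h B₁ := by
    rw [hB₀, hB₁]
    exact hh _ _ _ _ (hh _ _ _ _ (hKh x hx).1.symm (hKh y hy).2.1.symm) (hKh z hz).2.2.symm
  have hbalB₀ : ∀ i, letterBalance B₀ i =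
      K * (pathBalance a i + pathBalance b i + pathBalance g i) := by
    intro i
    rw [hB₀]
    simp only [letterBalance_append, Pi.add_apply, letterBalance_wordPow, hbal]
    ring
  have hbalB₁ : ∀ i, 0 ≤ letterBalance B₁ i := by
    intro i
    have h1 : letterBalance B₁ i = K * (s * (pathBalance a i + pathBalance b i)) := by
      rw [hB₁, ← hsum]
      simp only [letterBalance_append, Pi.add_apply, letterBalance_wordPow, hbal]
      push_cast
      ring
    have h2 : 0 ≤ pathBalance a i + pathBalance b i := hf.balance_nonneg i
    rw [h1]
    positivity
  obtain ⟨p, hp⟩ : ∃ p, p = (List.replicate K a).flatten ++ (List.replicate K b).flatten ++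
    (List.replicate K g).flatten := ⟨_, rfl⟩
  have hpB₀ : (p.flatMap fun e => e.label.label) = B₀ := by
    rw [hp, List.flatMap_append, List.flatMap_append, flatMap_replicate_flatten,
      flatMap_replicate_flatten, flatMap_replicate_flatten, hB₀, hword]
  obtain ⟨W, w, hwL, hw⟩ := exists_language_word_of_cycle hlabel hG hf.final (p := p)
    (by
      refine ⟨?_, ?_⟩
      · rw [hp]
        intro h0
        obtain ⟨k, rfl⟩ : ∃ k, K = k + 1 := ⟨K - 1, by omega⟩
        rw [List.append_eq_nil_iff, List.append_eq_nil_iff, List.replicate_succ,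
          List.flatten_cons, List.append_eq_nil_iff] at h0
        exact hf.cycle_a.1 h0.1.1.1
      · rw [hp]
        exact isKMPath_append.2 ⟨c, isKMPath_append.2 ⟨c, hf.cycle_a.2.replicate K,
          hf.cycle_b.2.replicate K⟩, hf.cycle_g.2.replicate K⟩)
    (by
      rw [hp, counterEffect_append, counterEffect_append, counterEffect_replicate,
        counterEffect_replicate, counterEffect_replicate, ← nsmul_add, ← nsmul_add]
      exact nsmul_nonneg hf.effect_nonneg K)
  rw [hpB₀] at hw
  have hpre : ∀ J, concatPrefix (fun j => Nat.casesOn j W fun _ => B₀) (J + 1) =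
      W ++ wordPow B₀ J := fun J => by
    rw [concatPrefix_succ']
    exact congrArg (W ++ ·) (concatPrefix_const B₀ J)
  have hprelen : ∀ J, (concatPrefix (fun j => Nat.casesOn j W fun _ => B₀) (J + 1)).length =
      W.length + J * B₀.length := fun J => by
    rw [hpre, List.length_append, length_wordPow]
  have hwtake : ∀ J, w.take (W.length + J * B₀.length) = W ++ wordPow B₀ J := fun J => by
    rw [← hprelen, ← hw.prefix_eq, hpre]
  have hB₀pos : 0 < B₀.length := by
    by_contra h0
    obtain ⟨k, hk⟩ := hw.unbounded (W.length + 1)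
    have h1 := hk.trans (concatPrefix_length_mono _ (Nat.le_succ k))
    rw [Nat.succ_eq_add_one, hprelen, show B₀.length = 0 by omega] at h1
    omega
  have hB₁pos : 0 < B₁.length := by
    have h1 : B₀.length ≤ B₁.length := by
      rw [hB₀, hB₁]
      simp only [List.length_append, length_wordPow, mul_assoc]
      exact Nat.add_le_add (Nat.add_le_add (Nat.le_mul_of_pos_left _ hx)
        (Nat.le_mul_of_pos_left _ hy)) (Nat.le_mul_of_pos_left _ hz)
    omega
  -- The requested reserve pays for the whole rest `t` before the exchange starts (first two
  -- summands) and for any prefix of `B₁` (last summand).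
  obtain ⟨j, v, hvL, ⟨ζ, hζ⟩, hge, hboost⟩ := hpump w hwL
    (W.length + (B₁.length + 1) * B₀.length + B₁.length)
  obtain ⟨J, hJ1, hJ2⟩ : ∃ J, j ≤ W.length + J * B₀.length ∧
      W.length + J * B₀.length ≤ j + W.length + B₀.length := by
    have hex : ∃ J, j ≤ W.length + J * B₀.length :=
      ⟨j, by have := Nat.le_mul_of_pos_right j hB₀pos; omega⟩
    refine ⟨Nat.find hex, Nat.find_spec hex, ?_⟩
    rcases Nat.eq_zero_or_eq_succ_pred (Nat.find hex) with h0 | h0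
    · rw [h0]; omega
    · have h1 := Nat.find_min hex (show (Nat.find hex).pred < _ by omega)
      rw [h0, Nat.succ_mul]
      omega
  -- The exchange starts at a boundary between copies of `B₀`, with `B₁.length` copies kept after
  -- the first boundary at or beyond `j`. In a coordinate where `B₀` has positive balance they
  -- accumulate enough for any prefix of `B₁`.
  obtain ⟨l, hl⟩ : ∃ l, l = W.length + (J + B₁.length) * B₀.length := ⟨_, rfl⟩
  have hjl : j ≤ l := by
    rw [hl, add_mul]; omega
  have hlj : l - j ≤ W.length + (B₁.length + 1) * B₀.length := by
    rw [hl, add_mul, add_mul]; omega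
  obtain ⟨t, ht⟩ : ∃ t, t = (w.take l).drop j := ⟨_, rfl⟩
  have htw : ∀ r, r <+: t → w.take j ++ r = w.take (j + r.length) := by
    intro r hr
    have h1 : t = (w.drop j).take (l - j) := by rw [ht, Stream'.drop_take]
    rw [Stream'.take_add]
    congr 1
    have h2 := (w.drop j).take_isPrefix (show r.length ≤ l - j by
      have := hr.length_le
      rwa [h1, Stream'.length_take] at this)
    rw [h1] at hr
    exact (List.prefix_of_prefix_length_le hr h2 (by simp)).eq_of_length (by simp)
  have htlen : t.length = l - j := by
    rw [ht, List.length_drop, Stream'.length_take]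
  have hcat₀ : IsConcatenation (fun i => Nat.casesOn i (v ++ t) fun _ => B₀)
      (v ++ₛ w.drop j) := by
    rw [Stream'.append_drop_eq v w hjl, ← ht]
    have h1 := hw.drop (J + B₁.length + 1)
    rw [hprelen, ← hl] at h1
    have h2 : IsConcatenation (fun _ => B₀) (w.drop l) := by
      convert h1 using 1
      funext i
      rw [show J + B₁.length + 1 + i = (J + B₁.length + i) + 1 by omega]
    exact h2.cons (v ++ t)
  obtain ⟨w', hw'⟩ := exists_isConcatenation
    (u := fun i => Nat.casesOn i (v ++ t) fun _ => B₁) (fun N => ⟨N + 1, by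
      rw [concatPrefix_succ', List.length_append]
      change N ≤ _ + (concatPrefix (fun _ => B₁) N).length
      rw [concatPrefix_const, length_wordPow]
      have := Nat.le_mul_of_pos_right N hB₁pos
      omega⟩)
  have hw'R : w' ∈ R := hrepl _ _ _ _ (fun i => by
    cases i with
    | zero => rfl
    | succ i => exact hhB) hcat₀ hw' (hVR hvL)
  refine Set.disjoint_left.1 hRD hw'R (mem_dyckLanguage_of_periodic hw' ?_ hbalB₁ ?_)
  · intro q i hq
    rcases prefix_append_cases hq with h1 | ⟨r, hr, rfl⟩
    · have h2 := hζ q.length i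
      have h3 : q <+: (v ++ₛ ζ).take v.length := by
        have := Stream'.take_append_length_add v ζ 0
        rw [Nat.add_zero, Stream'.take_zero, List.append_nil] at this
        rwa [this]
      have h4 := (v ++ₛ ζ).take_isPrefix h1.length_le
      rwa [← (List.prefix_of_prefix_length_le h3 h4 (by simp)).eq_of_length (by simp)] at h2
    · rw [letterBalance_append, Pi.add_apply]
      by_cases hi : ∃ l, letterBalance (w.take l) i < 0
      · have h1 := hboost i hi
        have h2 := neg_length_le_letterBalance r i
        have h3 := hr.length_le
        have h4 := le_max_right (letterBalance (w.take j) i) 0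
        have h5 : ((r.length : ℕ) : ℤ) ≤ ((W.length + (B₁.length + 1) * B₀.length : ℕ) : ℤ) := by
          exact_mod_cast (by omega)
        push_cast at h1 h5
        linarith
      · push Not at hi
        have h1 := hi (j + r.length)
        rw [← htw r hr, letterBalance_append, Pi.add_apply] at h1
        have := hge i
        linarith
  · intro q i hq
    have hqlen := hq.length_le
    have hqbal := neg_length_le_letterBalance q i
    rw [letterBalance_append, Pi.add_apply]
    by_cases hi : ∃ l, letterBalance (w.take l) i < 0
    · have h1 := hboost i hi
      have h2 := neg_length_le_letterBalance t i
      have h4 := le_max_right (letterBalance (w.take j) i) 0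
      have h5 : ((t.length : ℕ) : ℤ) ≤ ((W.length + (B₁.length + 1) * B₀.length : ℕ) : ℤ) := by
        exact_mod_cast (by omega)
      have h6 : (q.length : ℤ) ≤ B₁.length := by exact_mod_cast hqlen
      push_cast at h1 h5
      linarith
    · push Not at hi
      have h1 : letterBalance (w.take l) i ≤ letterBalance v i + letterBalance t i := by
        have h2 := htw t List.prefix_rfl
        rw [htlen, Nat.add_sub_cancel' hjl] at h2
        rw [← h2, letterBalance_append, Pi.add_apply]
        have := hge i
        linarith
      have h2 : ∀ k : ℕ, 0 ≤ letterBalance W i + k * letterBalance B₀ i := by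
        intro k
        have := hi (W.length + k * B₀.length)
        rwa [hwtake, letterBalance_append, Pi.add_apply, letterBalance_wordPow] at this
      rw [hl, hwtake, letterBalance_append, Pi.add_apply, letterBalance_wordPow] at h1
      rcases lt_trichotomy (letterBalance B₀ i) 0 with h3 | h3 | h3
      · exfalso
        have h4 := h2 ((letterBalance W i).toNat + 1)
        have h5 : (((letterBalance W i).toNat + 1 : ℕ) : ℤ) * letterBalance B₀ i ≤
            (((letterBalance W i).toNat + 1 : ℕ) : ℤ) * (-1) :=
          mul_le_mul_of_nonneg_left (by omega) (by positivity)
        omega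
      · have h5 : ∀ r, r <+: B₀ → 0 ≤ letterBalance W i + letterBalance r i := by
          intro r hr
          have h6 := hwtake 1
          have h7 : W ++ r <+: w.take (W.length + 1 * B₀.length) := by
            rw [h6]
            exact (List.prefix_append_right_inj _).2 (by simpa [wordPow] using hr)
          have h8 := w.take_isPrefix (show (W ++ r).length ≤ W.length + 1 * B₀.length by
            have := h7.length_le
            rwa [Stream'.length_take] at this)
          have h9 := hi (W ++ r).length
          rwa [← (List.prefix_of_prefix_length_le h7 h8 (by simp)).eq_of_length (by simp),
            letterBalance_append, Pi.add_apply] at h9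
        -- With zero balance of `B₀` nothing accumulates, but a prefix of `B₁` is never lower than
        -- some prefix of `B₀`, which is harmless after `W`.
        have h6 : ∃ r, r <+: B₀ ∧ letterBalance r i ≤ letterBalance q i := by
          rcases hcase with ⟨rfl, rfl, rfl⟩ | ⟨hzy, hzero⟩
          · refine ⟨q, ?_, le_rfl⟩
            rw [hB₁, one_mul, ← hB₀] at hq
            exact hq
          · have h7 : pathBalance a i + pathBalance b i + pathBalance g i = 0 := by
              have h8 := hbalB₀ i
              rw [h3] at h8
              rcases mul_eq_zero.1 h8.symm with h9 | h9
              · omega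
              · exact h9
            have h8 := hzero i h7
            have h9 : 0 ≤ pathBalance a i + pathBalance b i := hf.balance_nonneg i
            rw [hB₁] at hq
            rw [hB₀]
            exact exists_prefix_letterBalance_le hK hzy (by rw [hbal, h8])
              (by rw [hbal]; omega) (by rw [hbal, hbal]; omega) hq
        obtain ⟨r, hr, hrq⟩ := h6
        have h7 := h5 r hr
        rw [h3, mul_zero] at h1
        linarith
      · have h4 := h2 J
        have h5 : (B₁.length : ℤ) * 1 ≤ B₁.length * letterBalance B₀ i :=
          mul_le_mul_of_nonneg_left (by omega) (by positivity)
        have h6 : (q.length : ℤ) ≤ B₁.length := by exact_mod_cast hqlen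
        push_cast at h1
        rw [add_mul] at h1
        linarith

end FlowerInseparable

/-! ### Büchi automata over arbitrary finite state sets -/

section Transport

variable {S S' : Type*} {d : ℕ} {α : Type*}

/-- Renaming the states of a transition. -/
def VASSTransition.mapState (f : S → S') (t : VASSTransition S d α) : VASSTransition S' d α :=
  ⟨f t.src, t.label, t.effect, f t.tgt⟩

/-- Renaming the states of a Büchi VASS. -/
def BuchiVASS.mapState (V : BuchiVASS S d α) (f : S ≃ S') : BuchiVASS S' d α where
  init := f V.init
  trans := VASSTransition.mapState f '' V.trans
  finite_trans := V.finite_trans.image _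
  final := f '' V.final

theorem BuchiVASS.language_subset_mapState (V : BuchiVASS S d α) (f : S ≃ S') :
    V.language ⊆ (V.mapState f).language := by
  rintro w ⟨t, c, ⟨⟨h0, hrun⟩, hF⟩, hw⟩
  refine ⟨fun k => (t k).mapState f, fun k => (f (c k).1, (c k).2), ⟨⟨?_, fun k => ?_⟩, fun N => ?_⟩,
    hw⟩
  · dsimp only; rw [h0]; rfl
  · obtain ⟨h1, h2, h3, h4⟩ := hrun k
    exact ⟨⟨_, h1, rfl⟩, congrArg f h2, congrArg f h3, h4⟩
  · obtain ⟨k, hk, hkF⟩ := hF N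
    exact ⟨k, hk, ⟨_, hkF, rfl⟩⟩

theorem BuchiVASS.mapState_mapState_symm (V : BuchiVASS S d α) (f : S ≃ S') :
    (V.mapState f).mapState f.symm = V := by
  have h : ∀ t : VASSTransition S d α, (t.mapState f).mapState f.symm = t := fun t => by
    simp [VASSTransition.mapState]
  cases V
  simp [BuchiVASS.mapState, Set.image_image, h]

theorem BuchiVASS.isOmegaRegular_language [Finite S] (V : BuchiVASS S 0 α) :
    IsOmegaRegular V.language := by
  obtain ⟨m, ⟨f⟩⟩ := Finite.exists_equiv_fin S
  refine ⟨m, V.mapState f, Set.Subset.antisymm ?_ (V.language_subset_mapState f)⟩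
  have := (V.mapState f).language_subset_mapState f.symm
  rwa [V.mapState_mapState_symm f] at this

end Transport

/-! ### The separating automaton -/

section Separator

variable {Q : Type*} {d : ℕ} {n : ℕ}

/-- The change along an edge of the weighted letter balance, corrected by a potential. -/
def edgeWeight (y : Fin n → ℚ) (π : ExtConfig Q d → ℚ) (e : KMEdge Q d (DyckLetter n)) : ℚ :=
  ∑ i, y i * letterBalance e.label.label i + π e.tgt - π e.src

/-- Some non-negatively weighted letter balance, corrected by a potential, increases along no edge
of `E` and decreases along `e₀`. -/
def IsDecreasing {G : Set (KMEdge Q d (DyckLetter n))} (E : Set G) (e₀ : G) : Prop :=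
  ∃ (y : Fin n → ℚ) (π : ExtConfig Q d → ℚ), (∀ i, 0 ≤ y i) ∧
    (∀ e ∈ E, edgeWeight y π e.1 ≤ 0) ∧ edgeWeight y π e₀.1 < 0

/-- The states of the separating automaton: the last edge, and, after it has been guessed, a set
of edges that is not left any more together with one of its edges. -/
abbrev SeparatorState (G : Set (KMEdge Q d (DyckLetter n))) : Type _ :=
  Option G × Option (Set G × G)

/-- The node in which a path with the given last edge ends. -/
def lastNode (V : BuchiVASS Q d (DyckLetter n)) {G : Set (KMEdge Q d (DyckLetter n))}
    (e : Option G) : ExtConfig Q d :=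
  e.elim V.extInit fun e => e.1.tgt

/-- The steps of the separating automaton. -/
def IsSeparatorStep (V : BuchiVASS Q d (DyckLetter n)) {G : Set (KMEdge Q d (DyckLetter n))}
    (s : SeparatorState G) (e : G) (s' : SeparatorState G) : Prop :=
  e.1.src = lastNode V s.1 ∧ s'.1 = some e ∧
    ((s.2 = none ∧ ∀ x, s'.2 = some x → IsDecreasing x.1 x.2) ∨
      (s'.2 = s.2 ∧ ∃ x, s.2 = some x ∧ e ∈ x.1))

/-- The automaton that reads the labels of those paths of `G` which eventually use only edges of a
set along which some weighted balance decreases, and use infinitely often an edge along which it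
decreases strictly. -/
def separator (V : BuchiVASS Q d (DyckLetter n)) {G : Set (KMEdge Q d (DyckLetter n))}
    (hG : G.Finite) : BuchiVASS (SeparatorState G) 0 (DyckLetter n) where
  init := (none, none)
  trans := {t | ∃ s e s', IsSeparatorStep V s e s' ∧ t = ⟨s, e.1.label.label, 0, s'⟩}
  finite_trans := by
    have : Finite G := hG
    refine (Set.finite_range fun x : SeparatorState G × G × SeparatorState G =>
      (⟨x.1, x.2.1.1.label.label, 0, x.2.2⟩ : VASSTransition (SeparatorState G) 0 _)).subset ?_
    rintro _ ⟨s, e, s', -, rfl⟩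
    exact ⟨(s, e, s'), rfl⟩
  final := {s | ∃ E e, s = (some e, some (E, e))}

theorem exists_lt_of_frequently_decreasing (Φ : ℕ → ℚ) (k₁ : ℕ) (ε : ℚ) (hε : 0 < ε)
    (hmono : ∀ k, k₁ ≤ k → Φ (k + 1) ≤ Φ k)
    (hdec : ∀ N, ∃ k, N ≤ k ∧ Φ (k + 1) ≤ Φ k - ε) (B : ℚ) : ∃ k, k₁ ≤ k ∧ Φ k < B := by
  have hle : ∀ j k, k₁ ≤ j → Φ (j + k) ≤ Φ j := by
    intro j k hj
    induction k with
    | zero => exact le_rfl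
    | succ k ih => exact (hmono (j + k) (by omega)).trans ih
  have key : ∀ m : ℕ, ∃ k, k₁ ≤ k ∧ Φ k ≤ Φ k₁ - m * ε := by
    intro m
    induction m with
    | zero => exact ⟨k₁, le_rfl, by simp⟩
    | succ m ih =>
      obtain ⟨k, hk, hΦ⟩ := ih
      obtain ⟨l, hl, hl'⟩ := hdec k
      have h1 := hle k (l - k) hk
      rw [Nat.add_sub_cancel' hl] at h1
      refine ⟨l + 1, by omega, ?_⟩
      push_cast
      linarith
  obtain ⟨m, hm⟩ := exists_nat_gt ((Φ k₁ - B) / ε)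
  obtain ⟨k, hk, hΦ⟩ := key m
  rw [div_lt_iff₀ hε] at hm
  exact ⟨k, hk, by linarith⟩

/-- The weighted balance plus the potential is eventually non-increasing and drops by a fixed amount
at each use of the guessed edge. On a Dyck word it is bounded below, as the graph is finite and the
weights are non-negative. -/
theorem disjoint_language_separator (V : BuchiVASS Q d (DyckLetter n))
    {G : Set (KMEdge Q d (DyckLetter n))} (hG : G.Finite) :
    Disjoint (separator V hG).language (dyckLanguage n) := by
  refine Set.disjoint_left.2 ?_
  rintro w ⟨t, c, ⟨⟨h0, hrun⟩, hF⟩, hw⟩ hwD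
  have hstep : ∀ k, ∃ e : G, IsSeparatorStep V (c k).1 e (c (k + 1)).1 ∧
      (t k).label = e.1.label.label := by
    intro k
    obtain ⟨⟨s, e, s', hs, ht⟩, h2, h3, -⟩ := hrun k
    refine ⟨e, ?_, by rw [ht]⟩
    rw [← h2, ← h3, ht]
    exact hs
  choose η hη hlab using hstep
  have hdecr : ∀ k x, (c k).1.2 = some x → IsDecreasing x.1 x.2 := by
    intro k
    induction k with
    | zero => intro x hx; rw [h0] at hx; exact absurd hx (by simp [separator])
    | succ k ih =>
      intro x hx
      rcases (hη k).2.2 with ⟨-, h1⟩ | ⟨h1, -⟩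
      · exact h1 x hx
      · exact ih x (h1 ▸ hx)
  obtain ⟨k₁, -, E, e₀, hk₁⟩ := hF 0
  have hphase : ∀ k, k₁ ≤ k → (c k).1.2 = some (E, e₀) := by
    intro k hk
    induction k, hk using Nat.le_induction with
    | base => rw [hk₁]
    | succ k hk ih =>
      rcases (hη k).2.2 with ⟨h1, -⟩ | ⟨h1, -⟩
      · rw [ih] at h1; exact absurd h1 (by simp)
      · rw [h1, ih]
  obtain ⟨y, π, hy, hE, he₀⟩ := hdecr k₁ (E, e₀) (hphase k₁ le_rfl)
  have hηE : ∀ k, k₁ ≤ k → η k ∈ E := by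
    intro k hk
    rcases (hη k).2.2 with ⟨h1, -⟩ | ⟨-, x, h1, h2⟩
    · rw [hphase k hk] at h1; exact absurd h1 (by simp)
    · rw [hphase k hk] at h1
      obtain rfl := Option.some.inj h1
      exact h2
  have hsrc : ∀ k, (η (k + 1)).1.src = (η k).1.tgt := by
    intro k
    rw [(hη (k + 1)).1, (hη k).2.1]
    rfl
  let u : ℕ → List (DyckLetter n) := fun k => (t k).label
  let Φ : ℕ → ℚ := fun k => ∑ i, y i * letterBalance (concatPrefix u k) i + π (η k).1.src
  have hΦ : ∀ k, Φ (k + 1) = Φ k + edgeWeight y π (η k).1 := by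
    intro k
    simp only [Φ, edgeWeight, concatPrefix_succ, letterBalance_append, Pi.add_apply, hsrc]
    rw [show u k = (η k).1.label.label from hlab k]
    push_cast
    simp only [mul_add, Finset.sum_add_distrib]
    ring
  obtain ⟨B, hB⟩ := (hG.image fun e => π e.src).bddBelow
  obtain ⟨k, hk, hkB⟩ := exists_lt_of_frequently_decreasing Φ k₁ (-edgeWeight y π e₀.1)
    (by linarith) (fun k hk => by rw [hΦ]; linarith [hE _ (hηE k hk)])
    (fun N => by
      -- A final state records the edge just taken, so the strict decrease occurs one step earlier.
      obtain ⟨k, hk, E', e', hk'⟩ := hF (max (N + 1) (k₁ + 1))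
      obtain ⟨k, rfl⟩ : ∃ j, k = j + 1 := ⟨k - 1, by omega⟩
      refine ⟨k, by omega, ?_⟩
      have h1 := hphase (k + 1) (by omega)
      have h2 := (hη k).2.1
      rw [hk'] at h1 h2
      simp only [Option.some.injEq, Prod.mk.injEq] at h1 h2
      rw [hΦ, ← h2, h1.2]
      linarith) B
  have h1 : B ≤ π (η k).1.src := hB ⟨_, (η k).2, rfl⟩
  have h2 : 0 ≤ ∑ i, y i * (letterBalance (concatPrefix u k) i : ℚ) := by
    refine Finset.sum_nonneg fun i _ => mul_nonneg (hy i) ?_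
    rw [IsConcatenation.prefix_eq hw]
    exact_mod_cast hwD _ i
  simp only [Φ] at hkB
  linarith

/-! ### Accepting runs as infinite paths of the graph -/

theorem isKMPath_map_range {α : Type*} {G : Set (KMEdge Q d α)} {ε : ℕ → KMEdge Q d α}
    (hG : ∀ k, ε k ∈ G) (hε : ∀ k, (ε (k + 1)).src = (ε k).tgt) (k m : ℕ) :
    IsKMPath G (ε k).src ((List.range m).map fun i => ε (k + i)) (ε (k + m)).src := by
  induction m with
  | zero => rfl
  | succ m ih =>
    rw [List.range_succ, List.map_append]
    exact isKMPath_append.2 ⟨_, ih, hG _, rfl, (hε (k + m)).symm⟩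

theorem counterEffect_map_range {α : Type*} {ε : ℕ → KMEdge Q d α} {c : ℕ → Q × (Fin d → ℕ)}
    (hc : ∀ k i, ((c (k + 1)).2 i : ℤ) = (c k).2 i + (ε k).label.effect i) (k m : ℕ)
    (i : Fin d) :
    counterEffect ((List.range m).map fun i => ε (k + i)) i = (c (k + m)).2 i - (c k).2 i := by
  induction m with
  | zero => simp [counterEffect]
  | succ m ih =>
    rw [List.range_succ, List.map_append, counterEffect_append, Pi.add_apply, ih, List.map_singleton,
      counterEffect_cons, counterEffect_nil, add_zero, ← Nat.add_assoc, hc]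
    ring

/-- Every run of `V` follows a path of a Karp–Miller graph. -/
theorem IsKarpMillerGraph.exists_path_of_run {α : Type*} {V : BuchiVASS Q d α}
    {G : Set (KMEdge Q d α)} (hG : IsKarpMillerGraph V G) {t : ℕ → VASSTransition Q d α}
    {c : ℕ → Q × (Fin d → ℕ)} (hrun : V.IsRun t c) :
    ∃ ε : ℕ → KMEdge Q d α, (∀ k, ε k ∈ G) ∧ (ε 0).src = V.extInit ∧
      (∀ k, (ε (k + 1)).src = (ε k).tgt) ∧ (∀ k, (ε k).label = t k) ∧
      ∀ k, (ε k).src.1 = (c k).1 := by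
  have hstep : ∀ k (v : {v : ExtConfig Q d // KMReach G V.extInit v ∧ v.Covers (c k)}),
      ∃ (e : KMEdge Q d α) (v' : {v : ExtConfig Q d //
        KMReach G V.extInit v ∧ v.Covers (c (k + 1))}),
        e ∈ G ∧ e.src = v.1 ∧ e.label = t k ∧ e.tgt = v'.1 := by
    rintro k ⟨v, hv, hvc⟩
    obtain ⟨h1, h2, h3, h4⟩ := hrun.2 k
    obtain ⟨e, he, rfl, hl, hcov⟩ := hG.exists_edge hv hvc h1 h2 h3 h4
    exact ⟨e, ⟨e.tgt, hv.trans (KMReach.of_mem he), hcov⟩, he, rfl, hl, rfl⟩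
  choose e next he hsrc hlab htgt using hstep
  let node : ∀ k, {v : ExtConfig Q d // KMReach G V.extInit v ∧ v.Covers (c k)} := fun k =>
    Nat.rec ⟨V.extInit, KMReach.refl _ _, by rw [hrun.1]; exact ⟨rfl, fun i => Or.inr rfl⟩⟩
      (fun k v => next k v) k
  refine ⟨fun k => e k (node k), fun k => he k _, hsrc 0 _, fun k => ?_, fun k => hlab k _,
    fun k => ?_⟩
  · rw [hsrc, htgt]
  · rw [hsrc]
    exact (node k).2.2.1

/-- Along an infinite path of a finite graph that belongs to an accepting run, there is a cycle at
a final node with non-negative effect that consists of the edges used infinitely often. -/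
theorem exists_cycle_of_path {α : Type*} {V : BuchiVASS Q d α} {G : Set (KMEdge Q d α)}
    (hGfin : G.Finite) {ε : ℕ → KMEdge Q d α} {c : ℕ → Q × (Fin d → ℕ)} (hG : ∀ k, ε k ∈ G)
    (hε : ∀ k, (ε (k + 1)).src = (ε k).tgt)
    (hc : ∀ k i, ((c (k + 1)).2 i : ℤ) = (c k).2 i + (ε k).label.effect i)
    (hF : ∀ N, ∃ k, N ≤ k ∧ (ε k).src.1 ∈ V.final) :
    ∃ (v : ExtConfig Q d) (a : List (KMEdge Q d α)) (K : ℕ), v.1 ∈ V.final ∧ IsKMCycle G v a ∧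
      0 ≤ counterEffect a ∧ (∀ k, K ≤ k → ε k ∈ a) ∧ ∀ e ∈ a, ∀ N, ∃ k, N ≤ k ∧ ε k = e := by
  -- By finiteness of the graph, from some time `K` on only infinitely recurring edges are used.
  have hev : ∃ K, ∀ k, K ≤ k → ∀ N, ∃ l, N ≤ l ∧ ε l = ε k := by
    have h1 : ∀ᶠ k in Filter.atTop, ∀ e ∈ G, ε k = e → ∀ N, ∃ l, N ≤ l ∧ ε l = e := by
      rw [Filter.eventually_all_finite hGfin]
      intro e he
      by_cases h : ∀ N, ∃ l, N ≤ l ∧ ε l = e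
      · exact Filter.Eventually.of_forall fun _ _ => h
      · push Not at h
        obtain ⟨N, hN⟩ := h
        exact Filter.eventually_atTop.2 ⟨N, fun k hk hke => absurd hke (hN k hk)⟩
    obtain ⟨K, hK⟩ := Filter.eventually_atTop.1 h1
    exact ⟨K, fun k hk => hK k hk (ε k) (hG k) rfl⟩
  obtain ⟨K, hK⟩ := hev
  obtain ⟨k₀, hk₀, hk₀F⟩ := hF K
  obtain ⟨f, hf, hfp⟩ := Filter.extraction_of_frequently_atTop
    (P := fun k => ε k = ε k₀ ∧ K ≤ k) (Filter.frequently_atTop.2 fun N => by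
      obtain ⟨l, hl, hle⟩ := hK k₀ hk₀ (max N K)
      exact ⟨l, by omega, hle, by omega⟩)
  -- By Dickson's lemma, among the returns to one edge that leaves a final node, infinitely many
  -- have non-decreasing counters; a cycle between two of them has non-negative effect. The second
  -- is chosen beyond `B`, when all recurring edges have been seen.
  obtain ⟨g, hg⟩ := (wellQuasiOrdered_le (α := Fin d → ℕ)).exists_monotone_subseq
    fun i => (c (f i)).2
  have hseen : ∃ B, ∀ e ∈ G, (∀ N, ∃ l, N ≤ l ∧ ε l = e) →
      ∃ l, f (g 0) ≤ l ∧ l < B ∧ ε l = e := by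
    have h1 : ∀ᶠ B in Filter.atTop, ∀ e ∈ G, (∀ N, ∃ l, N ≤ l ∧ ε l = e) →
        ∃ l, f (g 0) ≤ l ∧ l < B ∧ ε l = e := by
      rw [Filter.eventually_all_finite hGfin]
      intro e he
      by_cases h : ∀ N, ∃ l, N ≤ l ∧ ε l = e
      · obtain ⟨l, hl, hle⟩ := h (f (g 0))
        exact Filter.eventually_atTop.2 ⟨l + 1, fun B hB _ => ⟨l, hl, by omega, hle⟩⟩
      · exact Filter.Eventually.of_forall fun _ h' => absurd h' h
    exact h1.exists
  obtain ⟨B, hB⟩ := hseen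
  obtain ⟨m, hm⟩ : ∃ m, f (g (B + 1)) = f (g 0) + m :=
    Nat.exists_eq_add_of_le (hf.monotone (g.monotone (Nat.zero_le _)))
  have hfB : B + 1 ≤ f (g (B + 1)) := (hf.comp g.strictMono).le_apply
  have hmem : ∀ k, f (g 0) ≤ k → k < B → ε k ∈ (List.range m).map fun i => ε (f (g 0) + i) :=
    fun k h1 h2 => List.mem_map.2 ⟨k - f (g 0), List.mem_range.2 (by omega), by
      rw [Nat.add_sub_cancel' h1]⟩
  have hm0 : m ≠ 0 := by
    rintro rfl
    have := hf (g.strictMono (Nat.succ_pos B))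
    rw [Nat.succ_eq_add_one] at this
    omega
  have hpath := isKMPath_map_range hG hε (f (g 0)) m
  rw [← hm, (hfp _).1, (hfp _).1] at hpath
  refine ⟨(ε k₀).src, (List.range m).map fun i => ε (f (g 0) + i), K, hk₀F, ⟨?_, hpath⟩, ?_, ?_, ?_⟩
  · simpa using hm0
  · intro i
    have h1 : (c (f (g 0))).2 i ≤ (c (f (g (B + 1)))).2 i := hg 0 (B + 1) (Nat.zero_le _) i
    have h2 := counterEffect_map_range hc (f (g 0)) m i
    rw [← hm] at h2
    rw [Pi.zero_apply, h2]
    exact sub_nonneg.2 (Int.ofNat_le.2 h1)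
  · intro k hk
    obtain ⟨l, hl1, hl2, hle⟩ := hB (ε k) (hG k) (hK k hk)
    rw [← hle]
    exact hmem l hl1 hl2
  · intro e he
    obtain ⟨i, -, rfl⟩ := List.mem_map.1 he
    exact hK _ (by have := (hfp (g 0)).2; omega)

/-- Without a special flower the Farkas alternative always yields a potential, so each accepting run
of `V` gives an accepting run of `separator`, which would then separate. -/
theorem exists_flower_of_not_regularlySeparable {V : BuchiVASS Q d (DyckLetter n)}
    {G : Set (KMEdge Q d (DyckLetter n))} (hG : IsKarpMillerGraph V G)
    (h : ¬ RegularlySeparable V.language (dyckLanguage n)) :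
    ∃ c a b g, IsInseparabilityFlower V G c a b g ∧ 0 ≤ counterEffect a ∧
      ∃ N : ℕ, 0 < N ∧ counterEffect b + counterEffect g = N • counterEffect a ∧
        pathBalance b + pathBalance g = N • pathBalance a := by
  classical
  by_contra hno
  have hGfin := hG.1.finite
  have : Finite G := hGfin
  refine h ⟨_, (separator V hGfin).isOmegaRegular_language, ?_, disjoint_language_separator V hGfin⟩
  rintro w ⟨t, c, ⟨hrun, hF⟩, hw⟩
  obtain ⟨ε, hεG, hε0, hεs, hεl, hεc⟩ := hG.exists_path_of_run hrun
  obtain ⟨v, a, K, hvF, ha, hδ, hK, hinf⟩ := exists_cycle_of_path (V := V) hGfin hεG hεs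
    (c := c) (fun k i => by rw [hεl]; exact (hrun.2 k).2.2.2 i)
    (fun N => by
      obtain ⟨k, hk, hkF⟩ := hF N
      exact ⟨k, hk, by rw [hεc]; exact hkF⟩)
  rcases exists_circulation_or_potential KMEdge.src KMEdge.tgt a.toFinset
    (fun e => letterBalance e.label.label) with ⟨X, hX1, hX2, hX3⟩ | ⟨y, π, hy, hE, e₀, he₀, hlt⟩
  · exact absurd ⟨v, a, exists_flower_of_circulation hvF ha hδ X
      (fun e => (hX1 e).trans List.mem_toFinset) hX2 hX3⟩ hno
  have hea : e₀ ∈ a := List.mem_toFinset.1 he₀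
  let E : Set G := {e | e.1 ∈ a}
  let e₁ : G := ⟨e₀, ha.2.mem e₀ hea⟩
  have hdec : IsDecreasing E e₁ := ⟨y, π, hy, fun e he => hE e.1 (List.mem_toFinset.2 he), hlt⟩
  -- The guess is made while taking edge `K`; all later edges lie on `a`, hence in `E`.
  let s : ℕ → SeparatorState G := fun k => Nat.casesOn k (none, none)
    fun k => (some ⟨ε k, hεG k⟩, if k < K then none else some (E, e₁))
  have hs : ∀ k, IsSeparatorStep V (s k) ⟨ε k, hεG k⟩ (s (k + 1)) := by
    intro k
    refine ⟨?_, rfl, ?_⟩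
    · cases k with
      | zero => exact hε0
      | succ k => exact hεs k
    · by_cases hk : ∃ j, k = j + 1 ∧ K ≤ j
      · obtain ⟨j, rfl, hj⟩ := hk
        refine Or.inr ⟨?_, (E, e₁), ?_, hK (j + 1) (by omega)⟩
        · change (if j + 1 < K then none else some (E, e₁)) =
            (if j < K then none else some (E, e₁))
          rw [if_neg (by omega), if_neg (by omega)]
        · exact if_neg (by omega)
      · refine Or.inl ⟨?_, fun x hx => ?_⟩
        · cases k with
          | zero => rfl
          | succ j => exact if_pos (by by_contra hj; exact hk ⟨j, rfl, by omega⟩)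
        · have hx' : (if k < K then none else some (E, e₁)) = some x := hx
          split_ifs at hx' with h1
          obtain rfl := Option.some.inj hx'
          exact hdec
  refine ⟨fun k => ⟨s k, (ε k).label.label, 0, s (k + 1)⟩, fun k => (s k, 0),
    ⟨⟨rfl, fun k => ⟨⟨s k, ⟨ε k, hεG k⟩, s (k + 1), hs k, rfl⟩, rfl, rfl, fun i => i.elim0⟩⟩,
      fun N => ?_⟩, ?_⟩
  · obtain ⟨k, hk, hke⟩ := hinf e₀ hea (max N K)
    refine ⟨k + 1, by omega, E, e₁, ?_⟩
    refine Prod.ext ?_ (if_neg (by omega))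
    exact congrArg some (Subtype.ext hke)
  · simp only [hεl]
    exact hw

end Separator

/-! ### The main theorem -/

theorem mainTheorem3 {Q : Type*} [Finite Q] (n d : ℕ) (V : BuchiVASS Q d (DyckLetter n))
    (hlabel : V.HasInfiniteLabels) (hpump : IsPumpable V.language) :
    (∃ G, IsKarpMillerGraph V G) ∧
    ∀ G, IsKarpMillerGraph V G →
      (¬ RegularlySeparable V.language (dyckLanguage n) ↔
        ∃ c a b g, IsInseparabilityFlower V G c a b g) ∧
      (¬ RegularlySeparable V.language (dyckLanguage n) →
        ∃ c a b g, IsInseparabilityFlower V G c a b g ∧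
          0 ≤ counterEffect a ∧
          ∃ N : ℕ, 0 < N ∧
            counterEffect b + counterEffect g = N • counterEffect a ∧
            pathBalance b + pathBalance g = N • pathBalance a) := by
  refine ⟨exists_isKarpMillerGraph V, fun G hG => ⟨⟨fun h => ?_, ?_⟩, fun h =>
    exists_flower_of_not_regularlySeparable hG h⟩⟩
  · obtain ⟨c, a, b, g, hf, -⟩ := exists_flower_of_not_regularlySeparable hG h
    exact ⟨c, a, b, g, hf⟩
  · rintro ⟨c, a, b, g, hf⟩
    exact hf.not_regularlySeparable hlabel hpump hG.1
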